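/- **Proposition (agreement with the GNVW index).** Let $d\ge 2$ and let $A$ be the quasi-local C*-algebra of the chain of qudits on $\mathbb Z$: the C*-inductive limit of the local algebras $A_I=\mathrm{End}((\mathbb C^d)^{\otimes I})$, for finite nonempty intervals $I\subset\mathbb Z$, along $w\mapsto 1\otimes w\otimes 1$. Then $A$ has a unique tracial state $\mathrm{tr}$. For $x\in\mathbb Z$ let $\mathcal A_x=(\bigcup_{I\le x}A_I)''\subseteq B(L^2(A,\mathrm{tr}))$. Every $\mathcal A_x$ is an infinite-dimensional factor, and the Jones index $[\mathcal A_z:\mathcal A_x]=\dim_{\mathcal A_x}L^2(\mathcal A_z)$ is finite for $x<z$. Let $\alpha$ be a quantum cellular automaton on $A$, that is, a $*$-automorphism of $A$ for which there is an $l\ge 0$ with $\alpha(A_{I})\subseteq A_{I^{+l}}$ and $\alpha^{-1}(A_I)\subseteq A_{I^{+l}}$ for all $I$, where $[a,b]^{+l}=[a-l,b+l]$; we then say that $\alpha$ has spread at most $l$. We also write $\alpha$ for its extension to $A''$. * *(Subfactor index.)* There are integers $y\le x$ with $\mathcal A_y\subseteq\alpha(\mathcal A_x)$; for all such $x,y$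 the Jones indices below are finite, and $$\mathrm{ind}(\alpha)=\left(\frac{[\alpha(\mathcal A_x):\mathcal A_y]}{[\mathcal A_x:\mathcal A_y]}\right)^{1/2}$$ is a positive number that does not depend on the choice of $x,y$. * *(GNVW index.)* For $m\ge 1$ such that $\alpha$ has spread at most $m$, and $c\in\mathbb Z$, group the sites into the cells $\{c+jm+1,\dots,c+(j+1)m\}$, $j\in\mathbb Z$, with cell algebras $B_j\cong M_{d^m}(\mathbb C)$, so that $\alpha$ is nearest-neighbour for the cells. Let $R\subseteq B_{-1}\otimes B_0$ be the support algebra of $\alpha(B_{-2}\otimes B_{-1})\subseteq (B_{-3}\otimes B_{-2})\otimes(B_{-1}\otimes B_0)$, i.e. the smallest $*$-subalgebra $S\subseteq B_{-1}\otimes B_0$ with $\alpha(B_{-2}\otimes B_{-1})\subseteq (B_{-3}\otimes B_{-2})\otimes S$. Then $$\mathrm{ind}_{\mathrm{GNVW}}(\alpha)=\left(\frac{\dim R}{\dim B_{-1}}\right)^{1/2}$$ does not depend on the choice of $m$ and $c$. (The translation to the right by one site has index $d$.) For every quantum cellular automaton $\alpha$ on $A$ the two indices agree: $\mathrm{ind}(\alpha)=\mathrm{ind}_{\mathrm{GNVW}}(\alpha)$.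 -/

import Mathlib

open scoped ComplexOrder ENNReal

noncomputable section

/-! ## Von Neumann algebras, Murray–von Neumann dimension, Jones index -/

namespace VonNeumannAlgebra

variable {H : Type*} [NormedAddCommGroup H] [InnerProductSpace ℂ H] [CompleteSpace H]

/-- The von Neumann algebra `S''` generated by a set `S` of operators (the bicommutant of
`S ∪ S*`). -/
def generated (S : Set (H →L[ℂ] H)) : VonNeumannAlgebra H where
  toStarSubalgebra :=
    StarSubalgebra.centralizer ℂ (StarSubalgebra.centralizer ℂ S : Set (H →L[ℂ] H))
  centralizer_centralizer' := by simp

/-- The image `U M U*` of a von Neumann algebra `M` under conjugation by a unitary `U`. -/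
def conj (U : H ≃ₗᵢ[ℂ] H) (M : VonNeumannAlgebra H) : VonNeumannAlgebra H where
  toStarSubalgebra := M.toStarSubalgebra.map U.conjStarAlgEquiv.toStarAlgHom
  centralizer_centralizer' := by
    have key : ∀ s : Set (H →L[ℂ] H),
        Set.centralizer (U.conjStarAlgEquiv '' s) = U.conjStarAlgEquiv '' Set.centralizer s := by
      intro s
      ext x
      constructor
      · intro hx
        have e : U.conjStarAlgEquiv (U.conjStarAlgEquiv.symm x) = x := StarAlgEquiv.apply_symm_apply _ x
        refine ⟨U.conjStarAlgEquiv.symm x, fun y hy => ?_, e⟩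
        have h := hx _ (Set.mem_image_of_mem _ hy)
        apply EquivLike.injective U.conjStarAlgEquiv
        rw [map_mul, map_mul, e, h]
      · rintro ⟨z, hz, rfl⟩ _ ⟨y, hy, rfl⟩
        rw [← map_mul, ← map_mul, hz y hy]
    have h2 : ((M.toStarSubalgebra.map U.conjStarAlgEquiv.toStarAlgHom).carrier :
        Set (H →L[ℂ] H)) = U.conjStarAlgEquiv '' (M : Set (H →L[ℂ] H)) := rfl
    rw [h2, key, key, M.centralizer_centralizer]

/-- A factor: the center consists of the scalars only. -/
def IsFactor (M : VonNeumannAlgebra H) : Prop :=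
  ∀ T ∈ M, T ∈ M.commutant → ∃ c : ℂ, T = c • (1 : H →L[ℂ] H)

/-- For a von Neumann algebra `N` on `H` whose trace is the vector state of `Ω`, the standard
space `L²(N, tr)`, realized as the closed subspace `[N Ω]` of `H`. -/
def L2 (N : VonNeumannAlgebra H) (Ω : H) : Submodule ℂ H :=
  (Submodule.map ((ContinuousLinearMap.apply ℂ H Ω : (H →L[ℂ] H) →L[ℂ] H) :
    (H →L[ℂ] H) →ₗ[ℂ] H) N.toStarSubalgebra.toSubalgebra.toSubmodule).topologicalClosure

instance (N : VonNeumannAlgebra H) (Ω : H) : CompleteSpace (N.L2 Ω) :=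
  (Submodule.isClosed_topologicalClosure _).completeSpace_coe

/-- The trace vector, as an element of `L²(N, tr)`. -/
def L2one (N : VonNeumannAlgebra H) (Ω : H) : N.L2 Ω :=
  ⟨Ω, Submodule.le_topologicalClosure _ ⟨1, one_mem N.toStarSubalgebra, by simp⟩⟩

/-- `u` embeds the closed `N`-invariant subspace `K` into `L²(N, tr) ⊗ ℓ²(ℕ)`, `N`-linearly. -/
def IsModuleEmbedding (N : VonNeumannAlgebra H) (Ω : H) (K : Submodule ℂ H)
    (u : K →ₗᵢ[ℂ] lp (fun _ : ℕ => N.L2 Ω) 2) : Prop :=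
  ∀ T ∈ N, ∀ ξ η : K, (η : H) = T (ξ : H) →
    ∀ i : ℕ, ((u η : ∀ _ : ℕ, N.L2 Ω) i : H) = T ((u ξ : ∀ _ : ℕ, N.L2 Ω) i : H)

/-- The Murray–von Neumann dimension `dim_N(K)` of a closed `N`-invariant subspace `K ⊆ H`, where
`N` is a II₁ factor whose trace is the vector state of `Ω`. For an `N`-linear isometry
`u : K → L²(N) ⊗ ℓ²(ℕ)`, it is `(tr_{N'} ⊗ Tr)(u u*) = ∑ᵢ ⟪Ωᵢ, u u* Ωᵢ⟫ = ∑ᵢ ‖u* Ωᵢ‖²` with `Ωᵢ`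
the trace vector in the `i`-th summand. This number is the same for every `u`, so the infimum only
selects the common value; it is `∞` if there is no such `u`. -/
def mvnDim (N : VonNeumannAlgebra H) (Ω : H) (K : Submodule ℂ H) [CompleteSpace K] : ℝ≥0∞ :=
  ⨅ u : {u : K →ₗᵢ[ℂ] lp (fun _ : ℕ => N.L2 Ω) 2 // N.IsModuleEmbedding Ω K u},
    ∑' i : ℕ, ENNReal.ofReal
      (‖ContinuousLinearMap.adjoint u.1.toContinuousLinearMap
        (lp.single 2 i (N.L2one Ω))‖ ^ 2)

/-- The Jones index `[M : N] = dim_N(L²(M))` of an inclusion `N ⊆ M` of II₁ factors, where `Ω` is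
a vector whose vector state is the trace of `M`. -/
def jonesIndex (M N : VonNeumannAlgebra H) (Ω : H) : ℝ≥0∞ :=
  N.mvnDim Ω (M.L2 Ω)

end VonNeumannAlgebra

/-! ## Tracial states and their GNS representation -/

section Trace

variable {A : Type*} [CStarAlgebra A] [PartialOrder A] [StarOrderedRing A]

/-- A tracial state. -/
structure IsTracialState (τ : A →ₚ[ℂ] ℂ) : Prop where
  map_one : τ 1 = 1
  map_mul_comm : ∀ a b, τ (a * b) = τ (b * a)

/-- `τ` is the only tracial state of the C*-algebra. -/
structure IsUniqueTracialState (τ : A →ₚ[ℂ] ℂ) : Prop extends IsTracialState τ where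
  unique : ∀ φ : A →ₚ[ℂ] ℂ, IsTracialState φ → φ = τ

/-- A unique tracial state is invariant under every `*`-automorphism. -/
theorem IsUniqueTracialState.map_aut {τ : A →ₚ[ℂ] ℂ} (hτ : IsUniqueTracialState τ)
    (α : A ≃⋆ₐ[ℂ] A) (a : A) : τ (α a) = τ a := by
  have hpos : ∀ x : A, 0 ≤ x → 0 ≤ (τ.toLinearMap ∘ₗ (α : A →ₗ[ℂ] A)) x := fun x hx =>
    τ.map_nonneg (map_nonneg α hx)
  have happ : ∀ x : A, PositiveLinearMap.mk₀ (τ.toLinearMap ∘ₗ (α : A →ₗ[ℂ] A)) hpos x = τ (α x) :=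
    fun _ => rfl
  have := hτ.unique (PositiveLinearMap.mk₀ _ hpos)
    ⟨by rw [happ, map_one, hτ.map_one],
      fun a b => by rw [happ, happ, map_mul α, map_mul α, hτ.map_mul_comm]⟩
  rw [← happ, this]

/-- The vector `1 ∈ L²(A, τ)`. -/
def gnsVector (τ : A →ₚ[ℂ] ℂ) : τ.GNS := (τ.toPreGNS 1 : τ.GNS)

/-- The linear isometry `a ↦ α a` of `A` with the norm of `L²(A, τ)`. -/
def preGNSAut {τ : A →ₚ[ℂ] ℂ} (hτ : IsUniqueTracialState τ) (α : A ≃⋆ₐ[ℂ] A) :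
    τ.PreGNS →ₗᵢ[ℂ] τ.PreGNS where
  toLinearMap := τ.toPreGNS.toLinearMap ∘ₗ (α : A →ₗ[ℂ] A) ∘ₗ τ.ofPreGNS.toLinearMap
  norm_map' x := by
    rw [PositiveLinearMap.preGNS_norm_def, PositiveLinearMap.preGNS_norm_def]
    have := hτ.map_aut α (star (τ.ofPreGNS x) * τ.ofPreGNS x)
    rw [← this, map_mul α, map_star α]
    rfl

/-- The unitary `a ↦ α a` of `L²(A, τ)`, for a `*`-automorphism `α` of `A`. -/
def gnsUnitary {τ : A →ₚ[ℂ] ℂ} (hτ : IsUniqueTracialState τ) (α : A ≃⋆ₐ[ℂ] A) :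
    τ.GNS ≃ₗᵢ[ℂ] τ.GNS where
  toFun := (preGNSAut hτ α).toContinuousLinearMap.completion
  invFun := (preGNSAut hτ α.symm).toContinuousLinearMap.completion
  map_add' := by simp
  map_smul' := by simp
  left_inv x := by
    induction x using UniformSpace.Completion.induction_on with
    | hp => exact isClosed_eq (by fun_prop) (by fun_prop)
    | ih x => simp [preGNSAut]
  right_inv x := by
    induction x using UniformSpace.Completion.induction_on with
    | hp => exact isClosed_eq (by fun_prop) (by fun_prop)
    | ih x => simp [preGNSAut]
  norm_map' x := by
    induction x using UniformSpace.Completion.induction_on with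
    | hp => exact isClosed_eq (continuous_norm.comp (ContinuousLinearMap.continuous _)) continuous_norm
    | ih x => simp

/-- Conjugation by `gnsUnitary` extends `α` from `A` to the operators on `L²(A, τ)`; hence it
restricts to the unique normal extension of `α` to `A''`. -/
theorem gnsUnitary_conj {τ : A →ₚ[ℂ] ℂ} (hτ : IsUniqueTracialState τ) (α : A ≃⋆ₐ[ℂ] A) (a : A) :
    (gnsUnitary hτ α).conjStarAlgEquiv (τ.gnsStarAlgHom a) = τ.gnsStarAlgHom (α a) := by
  have h : ∀ x, gnsUnitary hτ α (τ.gnsStarAlgHom a x)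
      = τ.gnsStarAlgHom (α a) (gnsUnitary hτ α x) := by
    intro x
    induction x using UniformSpace.Completion.induction_on with
    | hp => exact isClosed_eq (by fun_prop) (by fun_prop)
    | ih x => simp [gnsUnitary, preGNSAut]
  ext x
  rw [LinearIsometryEquiv.conjStarAlgEquiv_apply_apply, h]
  simp

end Trace

/-! ## Abstract spin chains and quantum cellular automata -/

/-- The interval `I^{+l} = [a - l, b + l]` for `I = [a, b]`. -/
def NonemptyInterval.enlarge (I : NonemptyInterval ℤ) (l : ℕ) : NonemptyInterval ℤ :=
  ⟨(I.fst - l, I.snd + l), by have := I.fst_le_snd; simp only; omega⟩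

/-- An abstract spin chain with quasi-local algebra `A`. -/
structure AbstractSpinChain (A : Type*) [CStarAlgebra A] where
  /-- The local algebra `A_I`, for a finite nonempty interval `I ⊆ ℤ`. -/
  loc : NonemptyInterval ℤ → StarSubalgebra ℂ A
  mono : Monotone loc
  finiteDimensional : ∀ I, FiniteDimensional ℂ (loc I)
  locality : ∀ I J : NonemptyInterval ℤ, Disjoint (I : Set ℤ) (J : Set ℤ) →
    ∀ a ∈ loc I, ∀ b ∈ loc J, Commute a b
  dense : Dense (⋃ I, (loc I : Set A))

namespace AbstractSpinChain

section QCA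

variable {A : Type*} [CStarAlgebra A] (C : AbstractSpinChain A)

/-- `α(A_I) ⊆ A_{I^{+l}}` and `α⁻¹(A_I) ⊆ A_{I^{+l}}` for all `I`. -/
def HasSpreadLE (α : A ≃⋆ₐ[ℂ] A) (l : ℕ) : Prop :=
  ∀ I, ∀ a ∈ C.loc I, α a ∈ C.loc (I.enlarge l) ∧ α.symm a ∈ C.loc (I.enlarge l)

/-- A quantum cellular automaton. -/
def IsQCA (α : A ≃⋆ₐ[ℂ] A) : Prop := ∃ l : ℕ, C.HasSpreadLE α l

end QCA

section Index

variable {A : Type*} [CStarAlgebra A] [PartialOrder A] [StarOrderedRing A]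
  (C : AbstractSpinChain A)

/-- `𝒜_x`, the bicommutant in `B(L²(A, τ))` of the union of the `A_I` with `I ≤ x`. -/
def leftAlgebra (τ : A →ₚ[ℂ] ℂ) (x : ℤ) : VonNeumannAlgebra τ.GNS :=
  VonNeumannAlgebra.generated
    (τ.gnsStarAlgHom '' ⋃ I : {I : NonemptyInterval ℤ // I.snd ≤ x}, (C.loc I.1 : Set A))

/-- The image `α(𝒜_x)` under the extension of `α` to `A''`. -/
def imageLeftAlgebra {τ : A →ₚ[ℂ] ℂ} (hτ : IsUniqueTracialState τ) (α : A ≃⋆ₐ[ℂ] A) (x : ℤ) :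
    VonNeumannAlgebra τ.GNS :=
  (C.leftAlgebra τ x).conj (gnsUnitary hτ α)

/-- The (left) finite index property. -/
structure FiniteIndexProperty {τ : A →ₚ[ℂ] ℂ} (hτ : IsUniqueTracialState τ) : Prop where
  isFactor : ∀ x, (C.leftAlgebra τ x).IsFactor
  infiniteDimensional : ∀ x, ¬ FiniteDimensional ℂ (C.leftAlgebra τ x).toStarSubalgebra
  finite_index : ∀ x z, x < z →
    (C.leftAlgebra τ z).jonesIndex (C.leftAlgebra τ x) (gnsVector τ) < ⊤

/-- `r` is the subfactor index of `α`: whenever `y ≤ x` and `𝒜_y ⊆ α(𝒜_x)` (and there are such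
`x`, `y`), the Jones indices below are finite and `r = ([α(𝒜_x) : 𝒜_y] / [𝒜_x : 𝒜_y])^{1/2}`. -/
def HasIndex {τ : A →ₚ[ℂ] ℂ} (hτ : IsUniqueTracialState τ) (α : A ≃⋆ₐ[ℂ] A) (r : ℝ) : Prop :=
  (∃ x y : ℤ, y ≤ x ∧ C.leftAlgebra τ y ≤ C.imageLeftAlgebra hτ α x) ∧
  ∀ x y : ℤ, y ≤ x → C.leftAlgebra τ y ≤ C.imageLeftAlgebra hτ α x →
    (C.imageLeftAlgebra hτ α x).jonesIndex (C.leftAlgebra τ y) (gnsVector τ) < ⊤ ∧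
    (C.leftAlgebra τ x).jonesIndex (C.leftAlgebra τ y) (gnsVector τ) < ⊤ ∧
    r = √(((C.imageLeftAlgebra hτ α x).jonesIndex (C.leftAlgebra τ y) (gnsVector τ)).toReal /
      ((C.leftAlgebra τ x).jonesIndex (C.leftAlgebra τ y) (gnsVector τ)).toReal)

end Index

/-! ## The GNVW index -/

section GNVW

variable {A : Type*} [CStarAlgebra A]

/-- For `D ⊆ B₁ ⊗ B₂` (commuting subalgebras `B₁`, `B₂`), the support algebra of `D` in `B₁`:
the smallest `*`-subalgebra `S` of `B₁` with `D ⊆ S ⊗ B₂`. -/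
def _root_.supportAlgebra (D B₁ B₂ : StarSubalgebra ℂ A) : StarSubalgebra ℂ A :=
  sInf {S : StarSubalgebra ℂ A | S ≤ B₁ ∧ D ≤ S ⊔ B₂}

variable (C : AbstractSpinChain A)

/-- The local algebra of the sites in `[a, b]` (`ℂ` if there are none). -/
def locIcc (a b : ℤ) : StarSubalgebra ℂ A :=
  if h : a ≤ b then C.loc ⟨(a, b), h⟩ else ⊥

/-- Group the sites into the cells `c + (j m, (j + 1) m]`, `j ∈ ℤ`, of `m` sites, with cell
algebras `B_j`, so that a QCA `α` of spread at most `m` is nearest-neighbour. Then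
`α(B_{-2} ⊗ B_{-1}) ⊆ (B_{-3} ⊗ B_{-2}) ⊗ (B_{-1} ⊗ B_0)`. With `R` the support algebra of
`α(B_{-2} ⊗ B_{-1})` in `B_{-1} ⊗ B_0`, the right-moving part, the index is
`(dim R / dim B_{-1})^{1/2}`. -/
def gnvwIndexAt (α : A ≃⋆ₐ[ℂ] A) (m : ℕ) (c : ℤ) : ℝ :=
  √((Module.finrank ℂ
      (supportAlgebra
        ((C.locIcc (c - 2 * m + 1) c).map α.toStarAlgHom)
        (C.locIcc (c - m + 1) (c + m))
        (C.locIcc (c - 3 * m + 1) (c - m))) : ℝ) /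
    (Module.finrank ℂ (C.locIcc (c - m + 1) c) : ℝ))

/-- `r` is the Gross–Nesme–Vogts–Werner index of `α`: the value of `gnvwIndexAt` for every
regrouping into cells that makes `α` nearest-neighbour (and there is such a regrouping). -/
def HasGNVWIndex (α : A ≃⋆ₐ[ℂ] A) (r : ℝ) : Prop :=
  (∃ m : ℕ, 1 ≤ m ∧ C.HasSpreadLE α m) ∧
  ∀ m : ℕ, 1 ≤ m → C.HasSpreadLE α m → ∀ c : ℤ, r = C.gnvwIndexAt α m c

end GNVW

end AbstractSpinChain

/-! ## The qudit chain -/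

section Qudit

variable {d : ℕ}

/-- The configuration `s` with its values on `Λ` replaced by `u`. -/
def putConfig {Λ : Finset ℤ} (s : ℤ → Fin d) (u : Λ → Fin d) : ℤ → Fin d :=
  fun n => if h : n ∈ Λ then u ⟨n, h⟩ else s n

theorem restrict_putConfig {Λ : Finset ℤ} (s : ℤ → Fin d) (u : Λ → Fin d) :
    Λ.restrict (putConfig s u) = u := by
  ext n
  simp [putConfig]

theorem putConfig_putConfig {Λ : Finset ℤ} (s : ℤ → Fin d) (u v : Λ → Fin d) :
    putConfig (putConfig s u) v = putConfig s v := by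
  ext n
  by_cases h : n ∈ Λ <;> simp [putConfig, h]

theorem putConfig_restrict {Λ : Finset ℤ} (s : ℤ → Fin d) :
    putConfig s (Λ.restrict s) = s := by
  ext n
  by_cases h : n ∈ Λ <;> simp [putConfig, h]

theorem putConfig_comm {Λ Γ : Finset ℤ} (h : Disjoint Λ Γ) (s : ℤ → Fin d) (u : Λ → Fin d)
    (v : Γ → Fin d) : putConfig (putConfig s u) v = putConfig (putConfig s v) u := by
  ext n
  by_cases h1 : n ∈ Λ
  · have h2 : n ∉ Γ := Finset.disjoint_left.mp h h1
    simp [putConfig, h1, h2]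
  · by_cases h2 : n ∈ Γ <;> simp [putConfig, h1, h2]

/-- The Hilbert space with orthonormal basis the configurations of the qudits on the sites `ℤ`. -/
abbrev ConfigSpace (d : ℕ) := lp (fun _ : ℤ → Fin d => ℂ) 2

theorem sum_sq_le (f : ConfigSpace d) {X : Set (ℤ → Fin d)} (g : X → ℤ → Fin d)
    (hg : Function.Injective g) :
    Summable (fun s => ‖f (g s)‖ ^ 2) ∧ ∑' s, ‖f (g s)‖ ^ 2 ≤ ‖f‖ ^ 2 := by
  have h := lp.hasSum_norm (p := 2) (by norm_num) f
  simp only [ENNReal.toReal_ofNat, Real.rpow_ofNat] at h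
  refine ⟨h.summable.comp_injective hg, ?_⟩
  rw [← h.tsum_eq]
  exact Summable.tsum_le_tsum_of_inj g hg (fun _ _ => by positivity) (fun _ => le_rfl)
    (h.summable.comp_injective hg) h.summable

theorem putConfig_inj {Λ : Finset ℤ} (u v : Λ → Fin d) :
    Function.Injective (fun s : {s : ℤ → Fin d | Λ.restrict s = u} => putConfig s.1 v) := by
  rintro ⟨s, hs⟩ ⟨t, ht⟩ h
  have : putConfig (putConfig s v) u = putConfig (putConfig t v) u := by
    simpa using congrArg (fun x => putConfig x u) h
  rw [putConfig_putConfig, putConfig_putConfig] at this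
  have hs' : Λ.restrict s = u := hs
  have ht' : Λ.restrict t = u := ht
  rw [← hs', putConfig_restrict, hs', ← ht', putConfig_restrict] at this
  exact Subtype.ext this

theorem unit_summable {Λ : Finset ℤ} (u v : Λ → Fin d) (f : ConfigSpace d) :
    HasSum (fun s : ℤ → Fin d => ‖if Λ.restrict s = u then f (putConfig s v) else 0‖ ^ 2)
      (∑' s : {s : ℤ → Fin d | Λ.restrict s = u}, ‖f (putConfig s.1 v)‖ ^ 2) := by
  have h := (sum_sq_le f _ (putConfig_inj u v)).1.hasSum
  rw [← hasSum_subtype_iff_of_support_subset (s := {s : ℤ → Fin d | Λ.restrict s = u})]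
  · convert h using 2 with s
    have := s.2
    simp only [Set.mem_ofPred_eq] at this
    simp [this]
  · intro s hs
    by_contra hc
    simp only [Set.mem_ofPred_eq] at hc
    simp [hc] at hs

/-- The matrix unit `|u⟩⟨v|` on the sites `Λ`, acting on `ConfigSpace d`. -/
def unitOp {Λ : Finset ℤ} (u v : Λ → Fin d) : ConfigSpace d →L[ℂ] ConfigSpace d :=
  LinearMap.mkContinuous
    { toFun := fun f => ⟨fun s => if Λ.restrict s = u then f (putConfig s v) else 0, by
        refine memℓp_gen ?_
        simpa using (unit_summable u v f).summable⟩
      map_add' := fun f g => by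
        ext s
        change (if Λ.restrict s = u then (f + g) (putConfig s v) else 0) =
          (if Λ.restrict s = u then f (putConfig s v) else 0) +
            if Λ.restrict s = u then g (putConfig s v) else 0
        by_cases h : Λ.restrict s = u <;> simp [h]
      map_smul' := fun c f => by
        ext s
        change (if Λ.restrict s = u then (c • f) (putConfig s v) else 0) =
          c • (if Λ.restrict s = u then f (putConfig s v) else 0)
        by_cases h : Λ.restrict s = u <;> simp [h] } 1 (by
    intro f
    rw [one_mul, ← sq_le_sq₀ (norm_nonneg _) (norm_nonneg _)]
    refine le_trans (le_of_eq ?_) (sum_sq_le f _ (putConfig_inj u v)).2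
    have h := lp.hasSum_norm (p := 2) (by norm_num)
      (⟨fun s => if Λ.restrict s = u then f (putConfig s v) else 0, by
        refine memℓp_gen ?_
        simpa using (unit_summable u v f).summable⟩ : ConfigSpace d)
    simp only [ENNReal.toReal_ofNat, Real.rpow_ofNat] at h
    exact h.unique (unit_summable u v f))

theorem unitOp_apply {Λ : Finset ℤ} (u v : Λ → Fin d) (f : ConfigSpace d) (s : ℤ → Fin d) :
    unitOp u v f s = if Λ.restrict s = u then f (putConfig s v) else 0 := rfl

theorem unitOp_adjoint {Λ : Finset ℤ} (u v : Λ → Fin d) :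
    star (unitOp u v) = unitOp v u := by
  symm
  rw [ContinuousLinearMap.star_eq_adjoint, ContinuousLinearMap.eq_adjoint_iff]
  intro f g
  rw [lp.inner_eq_tsum, lp.inner_eq_tsum]
  have hu : ∀ t : Function.support fun i => inner ℂ (f i) (unitOp u v g i),
      Λ.restrict t.1 = u := by
    intro t
    by_contra hc
    exact t.2 (by simp [unitOp_apply, hc])
  refine tsum_eq_tsum_of_ne_zero_bij (fun t => putConfig t.1 v) ?_ ?_ ?_
  · intro s t h
    have h' := @putConfig_inj d Λ u v ⟨s.1, hu s⟩ ⟨t.1, hu t⟩ h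
    exact Subtype.ext (Subtype.mk.inj h')
  · intro s hs
    have hv : Λ.restrict s = v := by
      by_contra hc
      exact hs (by simp [unitOp_apply, hc])
    have hsv : putConfig (putConfig s u) v = s := by
      rw [putConfig_putConfig, ← hv, putConfig_restrict]
    refine ⟨⟨putConfig s u, ?_⟩, hsv⟩
    simpa [unitOp_apply, restrict_putConfig, hsv, hv] using hs
  · intro t
    have h := hu t
    generalize t.1 = t at h
    have h2 : putConfig (putConfig t v) u = t := by
      rw [putConfig_putConfig, ← h, putConfig_restrict]
    simp [unitOp_apply, restrict_putConfig, h, h2]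

/-- The operator on `ConfigSpace d` of a matrix `M ∈ End((ℂ^d)^{⊗Λ})`, acting on the sites `Λ`
as `M` and on all other sites as the identity. -/
def localOp {Λ : Finset ℤ} (M : Matrix (Λ → Fin d) (Λ → Fin d) ℂ) :
    ConfigSpace d →L[ℂ] ConfigSpace d :=
  ∑ u, ∑ v, M u v • unitOp u v

theorem localOp_apply {Λ : Finset ℤ} (M : Matrix (Λ → Fin d) (Λ → Fin d) ℂ)
    (f : ConfigSpace d) (s : ℤ → Fin d) :
    localOp M f s = ∑ v, M (Λ.restrict s) v * f (putConfig s v) := by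
  have h : localOp M f s = ∑ u, ∑ v, M u v * unitOp u v f s := by
    have h1 : localOp M f = ∑ u, ∑ v, M u v • unitOp u v f := by
      simp [localOp]
    rw [h1, lp.coeFn_sum, Finset.sum_apply]
    refine Finset.sum_congr rfl fun u _ => ?_
    rw [lp.coeFn_sum, Finset.sum_apply]
    rfl
  rw [h, Finset.sum_eq_single (Λ.restrict s)]
  · simp [unitOp_apply]
  · intro u _ hu
    simp [unitOp_apply, Ne.symm hu]
  · simp

/-- `localOp` as a `*`-homomorphism: the action of `End((ℂ^d)^{⊗Λ})` on `ConfigSpace d`. -/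
def localHom (d : ℕ) (Λ : Finset ℤ) : Matrix (Λ → Fin d) (Λ → Fin d) ℂ →⋆ₐ[ℂ]
    (ConfigSpace d →L[ℂ] ConfigSpace d) where
  toFun := localOp
  map_one' := by
    ext f s
    simp [localOp_apply, Matrix.one_apply, putConfig_restrict]
  map_mul' M N := by
    ext f s
    change localOp (M * N) f s = localOp M (localOp N f) s
    simp only [localOp_apply, Matrix.mul_apply,
      restrict_putConfig, putConfig_putConfig, Finset.sum_mul, Finset.mul_sum, mul_assoc]
    exact Finset.sum_comm
  map_zero' := by
    ext f s
    simp [localOp_apply]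
  map_add' M N := by
    ext f s
    simp [localOp_apply, add_mul, Finset.sum_add_distrib]
  commutes' c := by
    ext f s
    simp [localOp_apply, Matrix.one_apply, putConfig_restrict,
      Algebra.algebraMap_eq_smul_one]
  map_star' M := by
    simp only [localOp, star_sum, star_smul, unitOp_adjoint, Matrix.star_apply]
    exact Finset.sum_comm

/-- Tensoring with identities: a matrix on `Λ` as a matrix on a larger set `Γ` of sites. -/
def padMatrix {Λ Γ : Finset ℤ} (h : Λ ⊆ Γ) (M : Matrix (Λ → Fin d) (Λ → Fin d) ℂ) :
    Matrix (Γ → Fin d) (Γ → Fin d) ℂ :=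
  fun s t => if (∀ n : Γ, (n : ℤ) ∉ Λ → s n = t n) then
    M (fun n => s ⟨n, h n.2⟩) (fun n => t ⟨n, h n.2⟩) else 0

theorem localOp_pad {Λ Γ : Finset ℤ} (h : Λ ⊆ Γ) (M : Matrix (Λ → Fin d) (Λ → Fin d) ℂ) :
    localOp (padMatrix h M) = localOp M := by
  ext f s
  rw [localOp_apply, localOp_apply]
  symm
  refine Finset.sum_of_injOn (fun v => Γ.restrict (putConfig s v)) ?_ ?_ ?_ ?_
  · intro v _ w _ hvw
    ext n
    have := congrFun hvw ⟨n, h n.2⟩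
    simpa [putConfig] using congrArg Fin.val this
  · intro v _
    simp
  · intro t _ ht
    rw [padMatrix, if_neg, zero_mul]
    intro hc
    apply ht
    refine ⟨fun n => t ⟨n, h n.2⟩, by simp, ?_⟩
    ext n
    by_cases hn : (n : ℤ) ∈ Λ
    · simp [putConfig, hn]
    · simpa [putConfig, hn] using congrArg Fin.val (hc n hn)
  · intro v _
    have h1 : putConfig s (Γ.restrict (putConfig s v)) = putConfig s v := by
      ext n
      by_cases hn : n ∈ Γ
      · simp [putConfig, hn]
      · have : n ∉ Λ := fun h' => hn (h h')
        simp [putConfig, hn, this]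
    rw [h1, padMatrix, if_pos]
    · congr 1
      congr 1
      ext n
      simp [putConfig]
    · intro n hn
      simp [putConfig, hn]

theorem localOp_commute {Λ Γ : Finset ℤ} (h : Disjoint Λ Γ)
    (M : Matrix (Λ → Fin d) (Λ → Fin d) ℂ) (N : Matrix (Γ → Fin d) (Γ → Fin d) ℂ) :
    Commute (localOp M) (localOp N) := by
  have r1 : ∀ (s : ℤ → Fin d) (u : Λ → Fin d), Γ.restrict (putConfig s u) = Γ.restrict s := by
    intro s u
    ext n
    have : (n : ℤ) ∉ Λ := fun h' => Finset.disjoint_left.mp h h' n.2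
    simp [putConfig, this]
  have r2 : ∀ (s : ℤ → Fin d) (u : Γ → Fin d), Λ.restrict (putConfig s u) = Λ.restrict s := by
    intro s u
    ext n
    have : (n : ℤ) ∉ Γ := Finset.disjoint_left.mp h n.2
    simp [putConfig, this]
  ext f s
  change localOp M (localOp N f) s = localOp N (localOp M f) s
  simp only [localOp_apply, r1, r2, Finset.mul_sum]
  rw [Finset.sum_comm]
  refine Finset.sum_congr rfl fun u _ => Finset.sum_congr rfl fun v _ => ?_
  rw [putConfig_comm h]
  ring

/-- The sites of an interval. -/
def sites (I : NonemptyInterval ℤ) : Finset ℤ := Finset.Icc I.fst I.snd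

theorem range_localHom_mono (d : ℕ) :
    Monotone fun I : NonemptyInterval ℤ => (localHom d (sites I)).range := by
  rintro I J hIJ _ ⟨M, rfl⟩
  have h : sites I ⊆ sites J := Finset.Icc_subset_Icc hIJ.1 hIJ.2
  exact ⟨padMatrix h M, localOp_pad h M⟩

/-- The `*`-algebra of all local operators of the qudit chain. -/
def localOperators (d : ℕ) : StarSubalgebra ℂ (ConfigSpace d →L[ℂ] ConfigSpace d) :=
  ⨆ I : NonemptyInterval ℤ, (localHom d (sites I)).range

/-- The quasi-local algebra of the qudit chain: the norm closure of the local operators. As a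
C*-algebra it is the inductive limit of the matrix algebras `End((ℂ^d)^{⊗I})` along
`M ↦ 1 ⊗ M ⊗ 1`. -/
def QuasiLocal (d : ℕ) : Type := (localOperators d).topologicalClosure

instance (d : ℕ) : CStarAlgebra (QuasiLocal d) :=
  StarSubalgebra.cstarAlgebra (localOperators d).topologicalClosure
    (h_closed := StarSubalgebra.isClosed_topologicalClosure _)

instance (d : ℕ) : PartialOrder (QuasiLocal d) := CStarAlgebra.spectralOrder _

instance (d : ℕ) : StarOrderedRing (QuasiLocal d) := CStarAlgebra.spectralOrderedRing _

/-- The inclusion of `End((ℂ^d)^{⊗I})` into the quasi-local algebra. -/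
def quditHom (d : ℕ) (I : NonemptyInterval ℤ) :
    Matrix (sites I → Fin d) (sites I → Fin d) ℂ →⋆ₐ[ℂ] QuasiLocal d :=
  (localHom d (sites I)).codRestrict (localOperators d).topologicalClosure fun M =>
    StarSubalgebra.le_topologicalClosure _
      (le_iSup (fun I : NonemptyInterval ℤ => (localHom d (sites I)).range) I ⟨M, rfl⟩)

/-- The chain of qudits with on-site Hilbert space `ℂ^d`: `A_I = End((ℂ^d)^{⊗I})`. -/
def quditChain (d : ℕ) : AbstractSpinChain (QuasiLocal d) where
  loc I := (quditHom d I).range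
  mono := by
    rintro I J hIJ _ ⟨M, rfl⟩
    obtain ⟨N, hN⟩ := range_localHom_mono d hIJ ⟨M, rfl⟩
    exact ⟨N, Subtype.ext hN⟩
  finiteDimensional I :=
    let g : Matrix (sites I → Fin d) (sites I → Fin d) ℂ →ₗ[ℂ] (quditHom d I).range :=
      { toFun := fun M => ⟨quditHom d I M, ⟨M, rfl⟩⟩
        map_add' := fun M N => Subtype.ext (map_add (quditHom d I) M N)
        map_smul' := fun c M => Subtype.ext (map_smul (quditHom d I) c M) }
    Module.Finite.of_surjective g (by rintro ⟨_, M, rfl⟩; exact ⟨M, rfl⟩)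
  locality I J h := by
    rintro _ ⟨M, rfl⟩ _ ⟨N, rfl⟩
    have hd : Disjoint (sites I) (sites J) := by
      rw [Finset.disjoint_left]
      intro n hI hJ
      exact Set.disjoint_left.mp h (Finset.mem_Icc.mp hI) (Finset.mem_Icc.mp hJ)
    exact Subtype.ext (localOp_commute hd M N)
  dense := by
    intro x
    have hdir : Directed (· ≤ ·) fun I : NonemptyInterval ℤ => (localHom d (sites I)).range :=
      (range_localHom_mono d).directed_le
    have hx : (x.1 : ConfigSpace d →L[ℂ] ConfigSpace d) ∈
        closure (localOperators d : Set (ConfigSpace d →L[ℂ] ConfigSpace d)) := x.2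
    have hcoe : (localOperators d : Set (ConfigSpace d →L[ℂ] ConfigSpace d)) =
        ⋃ I : NonemptyInterval ℤ, ((localHom d (sites I)).range : Set _) := by
      rw [localOperators, StarSubalgebra.coe_iSup_of_directed hdir]
    refine closure_subtype.mpr ?_
    rw [hcoe] at hx
    refine closure_mono ?_ hx
    intro T hT
    obtain ⟨I, M, rfl⟩ := Set.mem_iUnion.mp hT
    exact ⟨quditHom d I M, Set.mem_iUnion.mpr ⟨I, M, rfl⟩, rfl⟩

end Qudit

end

open scoped ComplexOrder ENNReal

noncomputable section

/-! ## Matrix units in a star algebra -/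

section MatrixUnits

open Matrix

variable {ι A : Type*} [Fintype ι] [DecidableEq ι] [Ring A] [StarRing A] [Algebra ℂ A]
  (h : Matrix ι ι ℂ →⋆ₐ[ℂ] A)

/-! Write `A_{≤x}` for the local operators on the sites `≤ x`, and let `F(x,y)` be the relative
commutant of `A_{≤y}` in `α(A_{≤x})`; this is `relComm α x y`. Both indices are square roots of `dim
F(x,y) / d^(2(x-y))`, called `indexRatio`.

The underlying fact is that a matrix algebra splits off as a tensor factor: expanding an operator in
matrix units gives coefficients commuting with them (`mem_sup_range_iff`), and these multiply
dimensions by the square of the matrix size (`finrank_sup_range`). Hence, if `A_{≤y} ⊆ α(A_{≤x})`,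
then `α(A_{≤x}) = A_{≤y} ⊗ F(x,y)`, where finite spread confines `F(x,y)` to the sites in `(y,
x+l]`. Lowering `y` or raising `x` tensors `F(x,y)` with a full matrix algebra, so `indexRatio`
depends neither on `x` nor on `y` (`indexRatio_eq`).

Subfactor side: the trace is multiplicative on `A_{≤y} ⊗ F(x,y)`, so a trace-orthonormal basis of
`F(x,y)` exhibits `L²(α(A_{≤x}))` as a free module of rank `dim F(x,y)` over the von Neumann algebra
of `A_{≤y}`, and the Jones index is this rank (`IsFreeBasis.mvnDim_eq`,
`IsTracialState.jonesIndex_imageLoc`). The identity automorphism gives the denominator. An inclusion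
of the von Neumann algebras already forces the inclusion of the local algebras
(`leftLoc_le_imageLoc_of_gnsVN_le`), so every admissible pair is covered.

GNVW side: the support algebra of the definition is exactly `F(c, c-m)`
(`supportAlgebra_eq_relComm`).

Tracial functionals on a matrix algebra are multiples of the trace. This makes the tracial state
unique, makes it multiplicative over disjoint sets of sites, and makes the half-line algebras
factors. -/

/-- The coefficient of `x` at the matrix unit `h (single u v 1)`, in the relative commutant of the
range of `h`. -/
def unitCoeff (u v : ι) : A →ₗ[ℂ] A where
  toFun x := ∑ k, h (single k u 1) * x * h (single v k 1)
  map_add' x y := by simp [mul_add, add_mul, Finset.sum_add_distrib]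
  map_smul' c x := by simp [Finset.smul_sum]

theorem unitCoeff_apply (u v : ι) (x : A) :
    unitCoeff h u v x = ∑ k, h (single k u 1) * x * h (single v k 1) := rfl

theorem sum_single_diag : ∑ k, h (single k k 1) = 1 := by
  rw [← map_sum, ← map_one h]
  congr 1
  ext i j
  by_cases hij : i = j <;> simp [Matrix.sum_apply, single_apply, Matrix.one_apply, hij]

theorem single_mul_eq (i j k l : ι) :
    h (single i j 1) * h (single k l 1) = if j = k then h (single i l 1) else 0 := by
  rw [← map_mul]
  split_ifs with hjk
  · subst hjk; simp
  · rw [single_mul_single_of_ne (h := hjk), map_zero]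

/-- Each summand equals `e_uu x e_vv`, and the diagonal matrix units sum to `1` on both sides of
`x`. -/
theorem sum_single_mul_unitCoeff (x : A) :
    ∑ u, ∑ v, h (single u v 1) * unitCoeff h u v x = x := by
  have : ∀ u v, h (single u v 1) * unitCoeff h u v x = h (single u u 1) * x * h (single v v 1) := by
    intro u v
    simp only [unitCoeff_apply, Finset.mul_sum, ← mul_assoc, single_mul_eq]
    simp
  simp only [this, ← Finset.mul_sum, sum_single_diag, mul_one]
  rw [← Finset.sum_mul, sum_single_diag, one_mul]

theorem single_mul_unitCoeff (a b u v : ι) (x : A) :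
    h (single a b 1) * unitCoeff h u v x = h (single a u 1) * x * h (single v b 1) := by
  simp only [unitCoeff_apply, Finset.mul_sum, ← mul_assoc, single_mul_eq]
  simp

theorem unitCoeff_mul_single (a b u v : ι) (x : A) :
    unitCoeff h u v x * h (single a b 1) = h (single a u 1) * x * h (single v b 1) := by
  simp only [unitCoeff_apply, Finset.sum_mul, mul_assoc, single_mul_eq]
  simp

theorem map_eq_sum_single (M : Matrix ι ι ℂ) : h M = ∑ i, ∑ j, M i j • h (single i j 1) := by
  conv_lhs => rw [matrix_eq_sum_single M]
  simp only [map_sum, ← map_smul, smul_single, smul_eq_mul, mul_one]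

theorem commute_map_of_single {x : A} (hx : ∀ i j, Commute (h (single i j 1)) x)
    (M : Matrix ι ι ℂ) : Commute (h M) x := by
  rw [map_eq_sum_single]
  exact Commute.sum_left _ _ _ fun i _ => Commute.sum_left _ _ _ fun j _ =>
    (hx i j).smul_left _

/-- Multiplying the coefficient by `e_ij` on the left or on the right gives the same operator `e_iu
x e_vj`. -/
theorem commute_unitCoeff (M : Matrix ι ι ℂ) (u v : ι) (x : A) :
    Commute (h M) (unitCoeff h u v x) := by
  refine commute_map_of_single h (fun i j => ?_) M
  rw [commute_iff_eq, single_mul_unitCoeff, unitCoeff_mul_single]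

theorem unitCoeff_of_commute {x : A} (hx : ∀ M, Commute (h M) x) (u v : ι) :
    unitCoeff h u v x = if u = v then x else 0 := by
  simp only [unitCoeff_apply, (hx _).eq, mul_assoc, single_mul_eq]
  split_ifs with huv
  · simp [← Finset.mul_sum, sum_single_diag]
  · simp

theorem unitCoeff_mul (u v : ι) (x y : A) :
    unitCoeff h u v (x * y) = ∑ w, unitCoeff h u w x * unitCoeff h w v y := by
  have : ∀ w, unitCoeff h u w x * unitCoeff h w v y =
      ∑ k, h (single k u 1) * x * h (single w w 1) * y * h (single v k 1) := by
    intro w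
    conv_lhs => rw [unitCoeff_apply h w v, Finset.mul_sum]
    simp only [← mul_assoc, unitCoeff_mul_single]
  simp only [this]
  rw [Finset.sum_comm, unitCoeff_apply]
  refine Finset.sum_congr rfl fun k _ => ?_
  simp only [← Finset.sum_mul, ← Finset.mul_sum, sum_single_diag, mul_assoc, one_mul]

theorem star_unitCoeff (u v : ι) (x : A) :
    star (unitCoeff h u v x) = unitCoeff h v u (star x) := by
  have : ∀ i j : ι, star (h (single i j 1)) = h (single j i 1) := by
    intro i j
    rw [← map_star, star_eq_conjTranspose, conjTranspose_single, star_one]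
  simp only [unitCoeff_apply, star_sum, star_mul, this, mul_assoc]

theorem unitCoeff_map (u v : ι) (M : Matrix ι ι ℂ) :
    unitCoeff h u v (h M) = algebraMap ℂ A (M u v) := by
  rw [unitCoeff_apply, Algebra.algebraMap_eq_smul_one, ← sum_single_diag h, Finset.smul_sum]
  refine Finset.sum_congr rfl fun k _ => ?_
  rw [← map_mul, ← map_mul, single_mul_mul_single, ← map_smul, smul_single]
  simp

theorem unitCoeff_sum_single_mul {g : ι → ι → A} (hg : ∀ i j M, Commute (h M) (g i j)) (u v : ι) :
    unitCoeff h u v (∑ i, ∑ j, h (single i j 1) * g i j) = g u v := by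
  simp only [map_sum, unitCoeff_mul, unitCoeff_map, unitCoeff_of_commute h (hg _ _)]
  simp only [mul_ite, mul_zero, Finset.sum_ite_eq', Finset.mem_univ, if_true, single_apply]
  rw [Finset.sum_eq_single u, Finset.sum_eq_single v]
  · simp
  · intro j _ hj; simp [hj]
  · simp
  · intro i _ hi; simp [hi]
  · simp

variable [StarModule ℂ A]

/-- A star subalgebra commuting with the matrix units, tensored with the matrix algebra. -/
def matrixOver (S : StarSubalgebra ℂ A) : StarSubalgebra ℂ A where
  carrier := {x | ∀ u v, unitCoeff h u v x ∈ S}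
  mul_mem' hx hy u v := by
    rw [unitCoeff_mul]
    exact sum_mem fun w _ => mul_mem (hx u w) (hy w v)
  add_mem' hx hy u v := by
    rw [map_add]
    exact add_mem (hx u v) (hy u v)
  algebraMap_mem' c u v := by
    rw [← AlgHomClass.commutes h c, unitCoeff_map]
    exact algebraMap_mem S _
  star_mem' hx u v := by
    rw [← star_unitCoeff]
    exact star_mem (hx v u)

/-- The condition that all coefficients lie in `S` defines a star subalgebra, because coefficients
multiply like matrices. It contains both generators, and the expansion in matrix units gives the
converse. -/
theorem sup_range_eq_matrixOver {S : StarSubalgebra ℂ A} (hS : ∀ s ∈ S, ∀ M, Commute (h M) s) :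
    S ⊔ h.range = matrixOver h S := by
  apply le_antisymm
  · refine sup_le (fun s hs u v => ?_) ?_
    · rw [unitCoeff_of_commute h (hS s hs)]
      split_ifs
      exacts [hs, zero_mem S]
    · rintro _ ⟨M, rfl⟩ u v
      exact (unitCoeff_map h u v M).symm ▸ algebraMap_mem S _
  · intro x hx
    rw [← sum_single_mul_unitCoeff h x]
    exact sum_mem fun u _ => sum_mem fun v _ => mul_mem
      (StarSubalgebra.mem_sup_right ⟨_, rfl⟩) (StarSubalgebra.mem_sup_left (hx u v))

theorem mem_sup_range_iff {S : StarSubalgebra ℂ A} (hS : ∀ s ∈ S, ∀ M, Commute (h M) s) {x : A} :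
    x ∈ S ⊔ h.range ↔ ∀ u v, unitCoeff h u v x ∈ S := by
  rw [sup_range_eq_matrixOver h hS]
  rfl

/-- An element commuting with the matrix algebra is its own diagonal coefficient, and coefficients
lie in `S`. One index is needed to have a diagonal entry. -/
theorem mem_of_mem_sup_range [Nonempty ι] {S : StarSubalgebra ℂ A}
    (hS : ∀ s ∈ S, ∀ M, Commute (h M) s) {x : A} (hx : x ∈ S ⊔ h.range)
    (hc : ∀ M, Commute (h M) x) : x ∈ S := by
  obtain ⟨u⟩ := ‹Nonempty ι›
  simpa [unitCoeff_of_commute h hc] using (mem_sup_range_iff h hS).1 hx u u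

theorem finrank_sup_range {S : StarSubalgebra ℂ A} (hS : ∀ s ∈ S, ∀ M, Commute (h M) s) :
    Module.finrank ℂ (S ⊔ h.range : StarSubalgebra ℂ A) =
      Fintype.card ι ^ 2 * Module.finrank ℂ S := by
  let e : (S ⊔ h.range : StarSubalgebra ℂ A) ≃ₗ[ℂ] Matrix ι ι S :=
    { toFun := fun x u v => ⟨unitCoeff h u v x.1, (mem_sup_range_iff h hS).1 x.2 u v⟩
      map_add' := fun x y => by ext u v; exact map_add (unitCoeff h u v) x.1 y.1
      map_smul' := fun c x => by ext u v; exact map_smul (unitCoeff h u v) c x.1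
      invFun := fun g => ⟨∑ u, ∑ v, h (single u v 1) * (g u v).1, sum_mem fun u _ =>
        sum_mem fun v _ => mul_mem (StarSubalgebra.mem_sup_right ⟨_, rfl⟩)
          (StarSubalgebra.mem_sup_left (g u v).2)⟩
      left_inv := fun x => Subtype.ext (sum_single_mul_unitCoeff h x.1)
      right_inv := fun g => by
        ext u v
        exact unitCoeff_sum_single_mul h (fun i j => hS _ (g i j).2) u v }
  rw [e.finrank_eq, Module.finrank_matrix, sq]

/-- Traciality applied to `e_ij = e_ik e_kj` kills the off-diagonal units and gives all diagonal
ones the same value. The form without division also covers an empty index type. -/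
theorem card_mul_eq_trace_mul {φ : Matrix ι ι ℂ →ₗ[ℂ] ℂ} (hφ : ∀ M N, φ (M * N) = φ (N * M))
    (M : Matrix ι ι ℂ) : Fintype.card ι * φ M = M.trace * φ 1 := by
  have h1 : ∀ i j k : ι, φ (single i j 1) = if i = j then φ (single k k 1) else 0 := by
    intro i j k
    have e : single i j (1 : ℂ) = single i k 1 * single k j 1 := by simp
    rw [e, hφ]
    split_ifs with hij
    · subst hij; simp
    · rw [single_mul_single_of_ne (h := fun hh => hij hh.symm), map_zero]
  have h2 : ∀ k (M : Matrix ι ι ℂ), φ M = M.trace * φ (single k k 1) := by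
    intro k M
    conv_lhs => rw [matrix_eq_sum_single M]
    have e : ∀ i j, single i j (M i j) = M i j • single i j (1 : ℂ) := by
      intro i j
      simp [smul_single]
    rw [Finset.sum_congr rfl fun i _ => Finset.sum_congr rfl fun j _ => e i j]
    simp only [map_sum, map_smul]
    rw [Finset.sum_congr rfl fun i _ => Finset.sum_congr rfl fun j _ =>
      congrArg (M i j • ·) (h1 i j k)]
    simp [Matrix.trace, Finset.sum_mul]
  rcases isEmpty_or_nonempty ι with hι | ⟨⟨k⟩⟩
  · simp
  · rw [h2 k M, h2 k 1, trace_one]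
    ring

end MatrixUnits

/-! ## Local algebras of the qudit chain -/

section Sites

open Matrix

variable {d : ℕ}

theorem exists_subset_sites (Λ : Finset ℤ) : ∃ I : NonemptyInterval ℤ, Λ ⊆ sites I := by
  obtain ⟨a, ha⟩ := Λ.bddBelow
  obtain ⟨b, hb⟩ := Λ.bddAbove
  refine ⟨⟨(min a b, max a b), by simp⟩, fun n hn => Finset.mem_Icc.2 ?_⟩
  exact ⟨(min_le_left a b).trans (ha hn), (hb hn).trans (le_max_right a b)⟩

/-- The inclusion of the matrix algebra of a finite set of sites into the quasi-local algebra. -/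
def siteHom (d : ℕ) (Λ : Finset ℤ) :
    Matrix (Λ → Fin d) (Λ → Fin d) ℂ →⋆ₐ[ℂ] QuasiLocal d :=
  (localHom d Λ).codRestrict (localOperators d).topologicalClosure fun M => by
    obtain ⟨I, hI⟩ := exists_subset_sites Λ
    exact StarSubalgebra.le_topologicalClosure _
      (le_iSup (fun I : NonemptyInterval ℤ => (localHom d (sites I)).range) I
        ⟨padMatrix hI M, localOp_pad hI M⟩)

/-- The algebra of a finite set of sites. -/
def siteAlg (d : ℕ) (Λ : Finset ℤ) : StarSubalgebra ℂ (QuasiLocal d) := (siteHom d Λ).range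

theorem siteHom_mem (Λ : Finset ℤ) (M : Matrix (Λ → Fin d) (Λ → Fin d) ℂ) :
    siteHom d Λ M ∈ siteAlg d Λ := ⟨M, rfl⟩

theorem siteAlg_mono {Λ Γ : Finset ℤ} (h : Λ ⊆ Γ) : siteAlg d Λ ≤ siteAlg d Γ := by
  rintro _ ⟨M, rfl⟩
  exact ⟨padMatrix h M, Subtype.ext (localOp_pad h M)⟩

theorem commute_of_disjoint {Λ Γ : Finset ℤ} (h : Disjoint Λ Γ) {a b : QuasiLocal d}
    (ha : a ∈ siteAlg d Λ) (hb : b ∈ siteAlg d Γ) : Commute a b := by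
  obtain ⟨M, rfl⟩ := ha
  obtain ⟨N, rfl⟩ := hb
  exact Subtype.ext (localOp_commute h M N)

theorem localOp_single_one {Λ : Finset ℤ} (u v : Λ → Fin d) :
    localOp (single u v 1) = unitOp u v := by
  ext f s
  rw [localOp_apply, unitOp_apply, Finset.sum_eq_single v]
  · simp [single_apply, eq_comm]
  · intro w _ hw
    simp [hw.symm]
  · simp

/-- A matrix unit of a tensor product is the product of matrix units of the factors; this is what
makes `siteAlg` multiplicative over disjoint unions. -/
theorem unitOp_union {Λ Γ : Finset ℤ} (h : Disjoint Λ Γ) (u v : ↥(Λ ∪ Γ) → Fin d) :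
    unitOp u v =
      unitOp (fun n : Λ => u ⟨n, Finset.mem_union_left Γ n.2⟩)
          (fun n : Λ => v ⟨n, Finset.mem_union_left Γ n.2⟩) *
        unitOp (fun n : Γ => u ⟨n, Finset.mem_union_right Λ n.2⟩)
          (fun n : Γ => v ⟨n, Finset.mem_union_right Λ n.2⟩) := by
  ext f s
  rw [mul_apply_eq_comp]
  simp only [unitOp_apply]
  have r : ∀ w : Λ → Fin d, Γ.restrict (putConfig s w) = Γ.restrict s := by
    intro w
    ext n
    have : (n : ℤ) ∉ Λ := fun h' => Finset.disjoint_left.mp h h' n.2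
    simp [putConfig, this]
  rw [r, ← ite_and]
  congr 1
  · rw [eq_iff_iff]
    constructor
    · rintro rfl
      exact ⟨rfl, rfl⟩
    · rintro ⟨h1, h2⟩
      ext ⟨n, hn⟩
      rcases Finset.mem_union.1 hn with hn' | hn'
      · exact congrArg Fin.val (congrFun h1 ⟨n, hn'⟩)
      · exact congrArg Fin.val (congrFun h2 ⟨n, hn'⟩)
  · refine congrArg f ?_
    ext n
    by_cases h1 : n ∈ Γ
    · simp [putConfig, h1]
    · by_cases h2 : n ∈ Λ <;> simp [putConfig, h1, h2]

theorem siteAlg_union {Λ Γ : Finset ℤ} (h : Disjoint Λ Γ) :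
    siteAlg d (Λ ∪ Γ) = siteAlg d Γ ⊔ siteAlg d Λ := by
  apply le_antisymm
  · rintro _ ⟨M, rfl⟩
    have e : ∀ u v, siteHom d (Λ ∪ Γ) (single u v 1) ∈ siteAlg d Γ ⊔ siteAlg d Λ := by
      intro u v
      have : siteHom d (Λ ∪ Γ) (single u v 1) = siteHom d Λ (single _ _ 1) *
          siteHom d Γ (single _ _ 1) := Subtype.ext (by
        have := unitOp_union h u v
        simp only [← localOp_single_one] at this
        exact this)
      rw [this]
      exact mul_mem (StarSubalgebra.mem_sup_right (siteHom_mem _ _))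
        (StarSubalgebra.mem_sup_left (siteHom_mem _ _))
    change siteHom d (Λ ∪ Γ) M ∈ _
    rw [map_eq_sum_single]
    exact sum_mem fun u _ => sum_mem fun v _ => StarSubalgebra.smul_mem _ (e u v) _
  · exact sup_le (siteAlg_mono Finset.subset_union_right) (siteAlg_mono Finset.subset_union_left)

theorem mem_siteAlg_of_commute [NeZero d] {Λ Γ : Finset ℤ} (h : Disjoint Λ Γ) {a : QuasiLocal d}
    (ha : a ∈ siteAlg d (Λ ∪ Γ)) (hc : ∀ b ∈ siteAlg d Λ, Commute b a) : a ∈ siteAlg d Γ := by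
  rw [siteAlg_union h] at ha
  exact mem_of_mem_sup_range (siteHom d Λ)
    (fun s hs M => commute_of_disjoint h (siteHom_mem _ _) hs) ha fun M => hc _ (siteHom_mem _ _)

theorem siteAlg_empty : siteAlg d ∅ = ⊥ := by
  refine eq_bot_iff.2 ?_
  rintro _ ⟨M, rfl⟩
  refine StarSubalgebra.mem_bot.2 ⟨M isEmptyElim isEmptyElim, ?_⟩
  change _ = siteHom d ∅ M
  rw [← AlgHomClass.commutes (siteHom d ∅)]
  congr 1
  ext u v
  rw [Subsingleton.elim u isEmptyElim, Subsingleton.elim v isEmptyElim]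
  simp [algebraMap_matrix_apply]

open Classical in
-- Basis vectors that agree off `Λ` recover the matrix entries. Off-diagonal entries give
-- faithfulness of `siteHom`, diagonal ones give the trace.
theorem localOp_lpSingle {Λ : Finset ℤ} (M : Matrix (Λ → Fin d) (Λ → Fin d) ℂ) (s : ℤ → Fin d)
    (u v : Λ → Fin d) :
    localOp M (lp.single 2 (putConfig s v) 1) (putConfig s u) = M u v := by
  rw [localOp_apply, Finset.sum_eq_single v]
  · simp [restrict_putConfig, putConfig_putConfig, lp.single_apply]
  · intro w _ hw
    have : putConfig s w ≠ putConfig s v := fun h => hw (by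
      rw [← restrict_putConfig s w, h, restrict_putConfig])
    simp [putConfig_putConfig, lp.single_apply, this]
  · simp

theorem siteHom_injective [NeZero d] (Λ : Finset ℤ) : Function.Injective (siteHom d Λ) := by
  classical
  intro M N h
  have h' : localOp M = localOp N := congrArg Subtype.val h
  ext u v
  rw [← localOp_lpSingle M 0 u v, h', localOp_lpSingle]

instance (Λ : Finset ℤ) : Module.Finite ℂ (siteAlg d Λ) :=
  Module.Finite.of_surjective (M := Matrix (Λ → Fin d) (Λ → Fin d) ℂ)
    ((siteHom d Λ).toAlgHom.rangeRestrict.toLinearMap : _ →ₗ[ℂ] (siteHom d Λ).toAlgHom.range)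
    (siteHom d Λ).toAlgHom.rangeRestrict_surjective

theorem finrank_siteAlg [NeZero d] (Λ : Finset ℤ) :
    Module.finrank ℂ (siteAlg d Λ) = d ^ (2 * Λ.card) := by
  have := (LinearEquiv.ofInjective (siteHom d Λ).toAlgHom.toLinearMap
    (siteHom_injective Λ)).finrank_eq
  refine Eq.trans this.symm ?_
  rw [Module.finrank_matrix]
  simp [← pow_add, two_mul]

/-- Half-open intervals concatenate without shifts, and the empty one corresponds to the scalars;
hence `Ioc` is used throughout, a cell of `m` sites being `(c-m, c]`. -/
theorem quditChain_locIcc (a b : ℤ) :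
    (quditChain d).locIcc (a + 1) b = siteAlg d (Finset.Ioc a b) := by
  have e : Finset.Ioc a b = Finset.Icc (a + 1) b := by ext n; simp
  rw [AbstractSpinChain.locIcc, e]
  split_ifs with h
  · rfl
  · rw [Finset.Icc_eq_empty h, siteAlg_empty]

theorem dense_siteAlg : Dense (⋃ Λ : Finset ℤ, (siteAlg d Λ : Set (QuasiLocal d))) := by
  refine (quditChain d).dense.mono ?_
  exact Set.iUnion_subset fun I => 
    Set.subset_iUnion (fun Λ : Finset ℤ => (siteAlg d Λ : Set (QuasiLocal d))) (sites I)

/-- The algebra of the local operators on the sites `≤ x`. -/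
def leftLoc (d : ℕ) (x : ℤ) : StarSubalgebra ℂ (QuasiLocal d) where
  carrier := {a | ∃ w, a ∈ siteAlg d (Finset.Ioc w x)}
  mul_mem' := by
    rintro a b ⟨v, hv⟩ ⟨w, hw⟩
    exact ⟨min v w, mul_mem (siteAlg_mono (Finset.Ioc_subset_Ioc_left (min_le_left v w)) hv)
      (siteAlg_mono (Finset.Ioc_subset_Ioc_left (min_le_right v w)) hw)⟩
  add_mem' := by
    rintro a b ⟨v, hv⟩ ⟨w, hw⟩
    exact ⟨min v w, add_mem (siteAlg_mono (Finset.Ioc_subset_Ioc_left (min_le_left v w)) hv)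
      (siteAlg_mono (Finset.Ioc_subset_Ioc_left (min_le_right v w)) hw)⟩
  algebraMap_mem' c := ⟨0, algebraMap_mem _ c⟩
  star_mem' := by
    rintro a ⟨w, hw⟩
    exact ⟨w, star_mem hw⟩

theorem siteAlg_le_leftLoc (w x : ℤ) : siteAlg d (Finset.Ioc w x) ≤ leftLoc d x :=
  fun _ ha => ⟨w, ha⟩

theorem leftLoc_mono {x y : ℤ} (h : x ≤ y) : leftLoc d x ≤ leftLoc d y := by
  rintro a ⟨w, hw⟩
  exact ⟨w, siteAlg_mono (Finset.Ioc_subset_Ioc_right h) hw⟩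

theorem coe_leftLoc (x : ℤ) : (leftLoc d x : Set (QuasiLocal d)) =
    ⋃ I : {I : NonemptyInterval ℤ // I.snd ≤ x}, ((quditChain d).loc I.1 : Set (QuasiLocal d)) := by
  ext a
  simp only [Set.mem_iUnion, SetLike.mem_coe]
  constructor
  · rintro ⟨w, hw⟩
    refine ⟨⟨⟨(min w x, x), min_le_right w x⟩, le_rfl⟩, siteAlg_mono (fun n hn => ?_) hw⟩
    rw [Finset.mem_Ioc] at hn
    exact Finset.mem_Icc.2 ⟨(min_le_left w x).trans hn.1.le, hn.2⟩
  · rintro ⟨⟨I, hI⟩, ha⟩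
    refine ⟨I.fst - 1, siteAlg_mono (fun n hn => ?_) ha⟩
    have hn' : I.fst ≤ n ∧ n ≤ I.snd := Finset.mem_Icc.1 hn
    change I.snd ≤ x at hI
    exact Finset.mem_Ioc.2 ⟨by omega, by omega⟩

theorem Ioc_union {a b c : ℤ} (h : a ≤ b) (h' : b ≤ c) :
    Finset.Ioc a b ∪ Finset.Ioc b c = Finset.Ioc a c := by
  ext n
  simp only [Finset.mem_union, Finset.mem_Ioc]
  omega

theorem disjoint_Ioc (a b c : ℤ) : Disjoint (Finset.Ioc a b) (Finset.Ioc b c) := by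
  rw [Finset.disjoint_left]
  intro n
  simp only [Finset.mem_Ioc]
  omega

theorem commute_leftLoc {x c : ℤ} {a b : QuasiLocal d} (ha : a ∈ leftLoc d x)
    (hb : b ∈ siteAlg d (Finset.Ioc x c)) : Commute a b := by
  obtain ⟨w, hw⟩ := ha
  exact commute_of_disjoint (disjoint_Ioc w x c) hw hb

theorem leftLoc_eq_sup {x z : ℤ} (h : x ≤ z) :
    leftLoc d z = leftLoc d x ⊔ siteAlg d (Finset.Ioc x z) := by
  apply le_antisymm
  · rintro a ⟨w, hw⟩
    have hw' := siteAlg_mono (Finset.Ioc_subset_Ioc_left (min_le_left w x)) hw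
    rw [← Ioc_union (min_le_right w x) h, siteAlg_union (disjoint_Ioc _ _ _), sup_comm] at hw'
    exact sup_le_sup_right (siteAlg_le_leftLoc _ _) _ hw'
  · exact sup_le (leftLoc_mono h) (siteAlg_le_leftLoc _ _)

/-- The relative commutant of `leftLoc d y` in `leftLoc d z`. -/
theorem mem_siteAlg_of_mem_leftLoc [NeZero d] {y z : ℤ} (h : y ≤ z) {a : QuasiLocal d}
    (ha : a ∈ leftLoc d z) (hc : ∀ b ∈ leftLoc d y, Commute b a) :
    a ∈ siteAlg d (Finset.Ioc y z) := by
  obtain ⟨w, hw⟩ := ha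
  have hw' := siteAlg_mono (Finset.Ioc_subset_Ioc_left (min_le_left w y)) hw
  rw [← Ioc_union (min_le_right w y) h] at hw'
  exact mem_siteAlg_of_commute (disjoint_Ioc _ _ _) hw' fun b hb =>
    hc b (siteAlg_le_leftLoc _ _ hb)

end Sites

/-! ## The tracial state of the qudit chain -/

section StateAux

variable {A : Type*} [CStarAlgebra A] [PartialOrder A] [StarOrderedRing A]

theorem PositiveLinearMap.continuous_functional (φ : A →ₚ[ℂ] ℂ) : Continuous φ := map_continuous φ

/-- A linear functional that is nonnegative at all `star a * a` is positive. -/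
def PositiveLinearMap.ofStarMulSelf (φ : A →ₗ[ℂ] ℂ) (h : ∀ a, 0 ≤ φ (star a * a)) : A →ₚ[ℂ] ℂ :=
  PositiveLinearMap.mk₀ φ fun a ha => by
    obtain ⟨b, rfl⟩ := CStarAlgebra.nonneg_iff_eq_star_mul_self.1 ha
    exact h b

end StateAux

section TracialState

open Matrix Filter Topology

variable {d : ℕ}

theorem card_mul_siteHom {φ : QuasiLocal d →ₗ[ℂ] ℂ} (Λ : Finset ℤ)
    (hφ : ∀ a ∈ siteAlg d Λ, ∀ b ∈ siteAlg d Λ, φ (a * b) = φ (b * a))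
    (M : Matrix (Λ → Fin d) (Λ → Fin d) ℂ) :
    Fintype.card (Λ → Fin d) * φ (siteHom d Λ M) = M.trace * φ 1 := by
  have := card_mul_eq_trace_mul (φ := φ ∘ₗ (siteHom d Λ).toAlgHom.toLinearMap)
    (fun M N => by simpa using hφ _ (siteHom_mem Λ M) _ (siteHom_mem Λ N)) M
  simpa using this

theorem card_config_ne_zero [NeZero d] (Λ : Finset ℤ) :
    (Fintype.card (Λ → Fin d) : ℂ) ≠ 0 := Nat.cast_ne_zero.2 Fintype.card_ne_zero

/-- A functional that is tracial on an algebra of finitely many sites is determined there by its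
value at `1`. -/
theorem eqOn_siteAlg [NeZero d] {φ ψ : QuasiLocal d →ₗ[ℂ] ℂ} (Λ : Finset ℤ)
    (hφ : ∀ a ∈ siteAlg d Λ, ∀ b ∈ siteAlg d Λ, φ (a * b) = φ (b * a))
    (hψ : ∀ a ∈ siteAlg d Λ, ∀ b ∈ siteAlg d Λ, ψ (a * b) = ψ (b * a))
    (h1 : φ 1 = ψ 1) {a : QuasiLocal d} (ha : a ∈ siteAlg d Λ) : φ a = ψ a := by
  obtain ⟨M, rfl⟩ := ha
  apply mul_left_cancel₀ (card_config_ne_zero (d := d) Λ)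
  exact (card_mul_siteHom Λ hφ M).trans (h1 ▸ (card_mul_siteHom Λ hψ M).symm)

/-- Both states are continuous, and on the dense union of matrix algebras each is the normalized
matrix trace. -/
theorem IsTracialState.isUnique [NeZero d] {τ : QuasiLocal d →ₚ[ℂ] ℂ} (hτ : IsTracialState τ) :
    IsUniqueTracialState τ where
  toIsTracialState := hτ
  unique φ hφ := by
    refine DFunLike.coe_injective (Continuous.ext_on (dense_siteAlg (d := d)) φ.continuous_functional
      τ.continuous_functional ?_)
    intro a ha
    obtain ⟨Λ, ha⟩ := Set.mem_iUnion.1 ha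
    exact eqOn_siteAlg (φ := φ.toLinearMap) (ψ := τ.toLinearMap) Λ
      (fun a _ b _ => hφ.map_mul_comm a b) (fun a _ b _ => hτ.map_mul_comm a b)
      (hφ.map_one.trans hτ.map_one.symm) ha

/-! ### Existence of the trace, as an ultrafilter limit of averages of diagonal entries over boxes.
-/

theorem eventually_mem_box {Λ : Finset ℤ} {a : QuasiLocal d} (ha : a ∈ siteAlg d Λ) :
    ∀ᶠ n : ℕ in hyperfilter ℕ, a ∈ siteAlg d (Finset.Icc (-n : ℤ) n) := by
  obtain ⟨I, hI⟩ := exists_subset_sites Λ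
  refine Nat.hyperfilter_le_atTop ?_
  filter_upwards [eventually_ge_atTop (max I.fst.natAbs I.snd.natAbs)] with n hn
  refine siteAlg_mono (hI.trans (Finset.Icc_subset_Icc ?_ ?_)) ha <;> omega

open Classical in
/-- The diagonal entry of an operator at a configuration. -/
def diagEntry (s : ℤ → Fin d) : QuasiLocal d →ₗ[ℂ] ℂ where
  toFun a := a.1 (lp.single 2 s 1) s
  map_add' _ _ := rfl
  map_smul' _ _ := rfl

open Classical in
theorem diagEntry_eq_inner (s : ℤ → Fin d) (a : QuasiLocal d) :
    diagEntry s a = inner ℂ (lp.single 2 s 1 : ConfigSpace d) (a.1 (lp.single 2 s 1)) := by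
  rw [lp.inner_single_left]
  simp only [RCLike.inner_apply, map_one, mul_one]
  rfl

theorem norm_diagEntry_le (s : ℤ → Fin d) (a : QuasiLocal d) : ‖diagEntry s a‖ ≤ ‖a‖ := by
  classical
  have h1 : ‖(lp.single 2 s 1 : ConfigSpace d)‖ = 1 := by
    rw [lp.norm_single (by norm_num)]
    simp
  rw [diagEntry_eq_inner]
  refine (norm_inner_le_norm _ _).trans ?_
  rw [h1, one_mul]
  refine (a.1.le_opNorm _).trans ?_
  rw [h1, mul_one]
  rfl

theorem diagEntry_star_mul_self_nonneg (s : ℤ → Fin d) (a : QuasiLocal d) :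
    0 ≤ diagEntry s (star a * a) := by
  classical
  rw [diagEntry_eq_inner]
  have : (star a * a).1 = star a.1 * a.1 := rfl
  rw [this, mul_apply_eq_comp, ContinuousLinearMap.star_eq_adjoint,
    ContinuousLinearMap.adjoint_inner_right, inner_self_eq_norm_sq_to_K]
  rw [← RCLike.ofReal_pow]
  exact RCLike.ofReal_nonneg.2 (sq_nonneg _)

variable [NeZero d]

/-- The normalized trace over the configurations of the sites in `[-n, n]`. -/
def boxTrace (n : ℕ) : QuasiLocal d →ₗ[ℂ] ℂ :=
  (Fintype.card (Finset.Icc (-n : ℤ) n → Fin d) : ℂ)⁻¹ •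
    ∑ u : Finset.Icc (-n : ℤ) n → Fin d, diagEntry (putConfig 0 u)

theorem boxTrace_apply (n : ℕ) (a : QuasiLocal d) :
    boxTrace n a = (Fintype.card (Finset.Icc (-n : ℤ) n → Fin d) : ℂ)⁻¹ *
      ∑ u : Finset.Icc (-n : ℤ) n → Fin d, diagEntry (putConfig 0 u) a := by
  simp [boxTrace]

theorem boxTrace_siteHom (n : ℕ) (M) :
    boxTrace n (siteHom d (Finset.Icc (-n : ℤ) n) M) =
      (Fintype.card (Finset.Icc (-n : ℤ) n → Fin d) : ℂ)⁻¹ * M.trace := by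
  rw [boxTrace_apply, Matrix.trace]
  congr 1
  exact Finset.sum_congr rfl fun u _ => localOp_lpSingle M 0 u u

theorem norm_boxTrace_le (n : ℕ) (a : QuasiLocal d) : ‖boxTrace n a‖ ≤ ‖a‖ := by
  rw [boxTrace_apply, norm_mul, norm_inv, inv_mul_le_iff₀ (norm_pos_iff.2 (card_config_ne_zero _))]
  refine (norm_sum_le _ _).trans ((Finset.sum_le_sum fun u _ => norm_diagEntry_le _ a).trans ?_)
  simp

/-- The averages stay in a compact disc of radius `‖a‖`, so they converge along the ultrafilter for
every `a`, local or not. Using one ultrafilter for all `a` makes the limit linear. -/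
theorem exists_boxTrace_limit (a : QuasiLocal d) :
    ∃ c, Tendsto (fun n => boxTrace n a) (hyperfilter ℕ) (𝓝 c) := by
  obtain ⟨c, -, hc⟩ := (isCompact_closedBall (0 : ℂ) ‖a‖).ultrafilter_le_nhds
    ((hyperfilter ℕ).map fun n => boxTrace n a)
    (by
      rw [le_principal_iff]
      exact Filter.univ_mem' (f := (hyperfilter ℕ : Filter ℕ)) fun n => by
        simpa using norm_boxTrace_le n a)
  exact ⟨c, hc⟩

/-- A limit point of the normalized traces `boxTrace`. -/
def limitTrace : QuasiLocal d →ₗ[ℂ] ℂ where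
  toFun a := (exists_boxTrace_limit a).choose
  map_add' a b := tendsto_nhds_unique (exists_boxTrace_limit (a + b)).choose_spec
    (by simpa using (exists_boxTrace_limit a).choose_spec.add (exists_boxTrace_limit b).choose_spec)
  map_smul' c a := tendsto_nhds_unique (exists_boxTrace_limit (c • a)).choose_spec
    (by simpa using (exists_boxTrace_limit a).choose_spec.const_mul c)

theorem tendsto_boxTrace (a : QuasiLocal d) :
    Tendsto (fun n => boxTrace n a) (hyperfilter ℕ) (𝓝 (limitTrace a)) :=
  (exists_boxTrace_limit a).choose_spec

/-- The tracial state of the qudit chain. -/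
def quditTrace (d : ℕ) [NeZero d] : QuasiLocal d →ₚ[ℂ] ℂ :=
  PositiveLinearMap.ofStarMulSelf limitTrace fun a =>
    -- Positivity passes to the limit: the diagonal entries of `star a * a` are squared norms.
    ge_of_tendsto' (tendsto_boxTrace _) fun n => by
      rw [boxTrace_apply]
      exact mul_nonneg (by positivity)
        (Finset.sum_nonneg fun u _ => diagEntry_star_mul_self_nonneg _ a)

theorem tendsto_quditTrace (a : QuasiLocal d) :
    Tendsto (fun n => boxTrace n a) (hyperfilter ℕ) (𝓝 (quditTrace d a)) :=
  tendsto_boxTrace a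

/-- Eventually both operators lie in the box `[-n, n]`, where `boxTrace n` is the normalized matrix
trace. -/
theorem quditTrace_mul_comm_of_mem {Λ Γ : Finset ℤ} {a b : QuasiLocal d} (ha : a ∈ siteAlg d Λ)
    (hb : b ∈ siteAlg d Γ) : quditTrace d (a * b) = quditTrace d (b * a) := by
  refine tendsto_nhds_unique_of_eventuallyEq (tendsto_quditTrace _) (tendsto_quditTrace _) ?_
  filter_upwards [eventually_mem_box ha, eventually_mem_box hb] with n hna hnb
  obtain ⟨M, rfl⟩ := hna
  obtain ⟨N, rfl⟩ := hnb
  change boxTrace n (siteHom d _ M * siteHom d _ N) = boxTrace n (siteHom d _ N * siteHom d _ M)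
  rw [← map_mul, ← map_mul, boxTrace_siteHom, boxTrace_siteHom, trace_mul_comm]

theorem isTracialState_quditTrace : IsTracialState (quditTrace d) where
  map_one := by
    refine tendsto_nhds_unique (tendsto_quditTrace 1) (tendsto_const_nhds.congr fun n => ?_)
    rw [← map_one (siteHom d (Finset.Icc (-n : ℤ) n)), boxTrace_siteHom, trace_one,
      inv_mul_cancel₀ (card_config_ne_zero _)]
  map_mul_comm a b := by
    have hc := (quditTrace d).continuous_functional
    -- Two density arguments, one variable at a time: first `b` becomes arbitrary with `a` local,
    -- then `a`.
    have h1 : ∀ {Λ : Finset ℤ} {a : QuasiLocal d}, a ∈ siteAlg d Λ → ∀ b,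
        quditTrace d (a * b) = quditTrace d (b * a) := by
      intro Λ a ha b
      refine congrFun (Continuous.ext_on (f := fun b => quditTrace d (a * b))
        (g := fun b => quditTrace d (b * a)) (dense_siteAlg (d := d)) (by fun_prop) (by fun_prop)
        fun b hb => ?_) b
      obtain ⟨Γ, hb⟩ := Set.mem_iUnion.1 hb
      exact quditTrace_mul_comm_of_mem ha hb
    refine congrFun (Continuous.ext_on (f := fun a => quditTrace d (a * b))
      (g := fun a => quditTrace d (b * a)) (dense_siteAlg (d := d)) (by fun_prop) (by fun_prop)
      fun a ha => ?_) a
    obtain ⟨Γ, ha⟩ := Set.mem_iUnion.1 ha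
    exact h1 ha b

namespace IsTracialState

variable {τ : QuasiLocal d →ₚ[ℂ] ℂ} (hτ : IsTracialState τ)
include hτ

theorem map_siteHom (Λ : Finset ℤ) (M : Matrix (Λ → Fin d) (Λ → Fin d) ℂ) :
    τ (siteHom d Λ M) = (Fintype.card (Λ → Fin d) : ℂ)⁻¹ * M.trace := by
  rw [eq_inv_mul_iff_mul_eq₀ (card_config_ne_zero _)]
  have := card_mul_siteHom (φ := τ.toLinearMap) Λ (fun a _ b _ => hτ.map_mul_comm a b) M
  simpa [hτ.map_one] using this

/-- For fixed `b`, the functional `x ↦ τ (x * b)` is tracial on `siteAlg d Λ`, since `b` commutes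
with that algebra. It is therefore a multiple of `τ` there, and `x = 1` gives the factor. -/
theorem map_mul_of_disjoint {Λ Γ : Finset ℤ} (h : Disjoint Λ Γ) {a b : QuasiLocal d}
    (ha : a ∈ siteAlg d Λ) (hb : b ∈ siteAlg d Γ) : τ (a * b) = τ a * τ b := by
  refine eqOn_siteAlg (φ := τ.toLinearMap ∘ₗ LinearMap.mulRight ℂ b)
    (ψ := τ b • τ.toLinearMap) Λ (fun x _ y hy => ?_) (fun x _ y _ => ?_) ?_ ha |>.trans
    (mul_comm _ _)
  · change τ (x * y * b) = τ (y * x * b)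
    rw [mul_assoc, (commute_of_disjoint h hy hb).eq, ← mul_assoc, hτ.map_mul_comm, mul_assoc]
  · change τ b * τ (x * y) = τ b * τ (y * x)
    rw [hτ.map_mul_comm]
  · change τ (1 * b) = τ b * τ 1
    rw [one_mul, hτ.map_one, mul_one]

theorem eq_zero_of_map_star_mul_self {Λ : Finset ℤ} {a : QuasiLocal d} (ha : a ∈ siteAlg d Λ)
    (h : τ (star a * a) = 0) : a = 0 := by
  obtain ⟨M, rfl⟩ := ha
  change τ (star (siteHom d Λ M) * siteHom d Λ M) = 0 at h
  rw [← map_star, ← map_mul, hτ.map_siteHom, mul_eq_zero,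
    or_iff_right (inv_ne_zero (card_config_ne_zero _)), star_eq_conjTranspose,
    trace_conjTranspose_mul_self_eq_zero_iff] at h
  rw [h]
  exact map_zero (siteHom d Λ)

end IsTracialState

end TracialState

/-! ## Murray–von Neumann dimension of free modules -/

namespace VonNeumannAlgebra

variable {H : Type*} [NormedAddCommGroup H] [InnerProductSpace ℂ H] [CompleteSpace H]

theorem map_mem_L2 {N : VonNeumannAlgebra H} {Ω : H} {T : H →L[ℂ] H} (hT : T ∈ N) {v : H}
    (hv : v ∈ N.L2 Ω) : T v ∈ N.L2 Ω := by
  refine map_mem_closure T.continuous (s := _) (t := _) hv ?_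
  rintro _ ⟨S, hS, rfl⟩
  exact ⟨T * S, mul_mem (S := VonNeumannAlgebra H) hT hS, rfl⟩

/-- The closed subspace `K` is the orthogonal sum of the `f k L²(N)` with `k < n`, where the
`f k` are operators in the commutant of `N` that are isometric on `L²(N)`. The operators in `N₀` are
dense in `N` and the vector state of `Ω` is a trace on them. -/
structure IsFreeBasis (N : VonNeumannAlgebra H) (Ω : H) (N₀ : StarSubalgebra ℂ (H →L[ℂ] H))
    (K : Submodule ℂ H) (n : ℕ) (f : ℕ → H →L[ℂ] H) : Prop where
  norm_one : ‖Ω‖ = 1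
  le : ∀ a ∈ N₀, a ∈ N
  norm_star : ∀ a ∈ N₀, ‖star a Ω‖ = ‖a Ω‖
  dense : ∀ v ∈ N.L2 Ω, v ∈ closure ((fun a : H →L[ℂ] H => a Ω) '' N₀)
  commute : ∀ k < n, ∀ T ∈ N, ∀ v, f k (T v) = T (f k v)
  orth : ∀ j < n, ∀ k < n, ∀ a ∈ N₀, ∀ b ∈ N₀,
    inner ℂ (f j (a Ω)) (f k (b Ω)) = if j = k then inner ℂ (a Ω) (b Ω) else 0
  mem : ∀ k < n, ∀ a ∈ N₀, f k (a Ω) ∈ K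
  isClosed : IsClosed (K : Set H)
  span : ∀ v ∈ K, v ∈ closure
    (Submodule.span ℂ {w | ∃ k < n, ∃ a ∈ N₀, w = f k (a Ω)} : Set H)

namespace IsFreeBasis

variable {N : VonNeumannAlgebra H} {Ω : H} {N₀ : StarSubalgebra ℂ (H →L[ℂ] H)}
  {K : Submodule ℂ H} {n : ℕ} {f : ℕ → H →L[ℂ] H} (h : IsFreeBasis N Ω N₀ K n f)
include h

theorem mem_of_mem_L2 {k : ℕ} (hk : k < n) {v : H} (hv : v ∈ N.L2 Ω) : f k v ∈ K := by
  have : f k v ∈ closure (K : Set H) := by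
    refine map_mem_closure (f k).continuous (h.dense v hv) ?_
    rintro _ ⟨a, ha, rfl⟩
    exact h.mem k hk a ha
  rwa [h.isClosed.closure_eq] at this

theorem apply_mem_L2 {a : H →L[ℂ] H} (ha : a ∈ N₀) : a Ω ∈ N.L2 Ω :=
  map_mem_L2 (h.le a ha) (N.L2one Ω).2

theorem inner_eq {j k : ℕ} (hj : j < n) (hk : k < n) {v w : H} (hv : v ∈ N.L2 Ω)
    (hw : w ∈ N.L2 Ω) : inner ℂ (f j v) (f k w) = if j = k then inner ℂ v w else 0 := by
  have hcl : IsClosed {p : H × H | inner ℂ (f j p.1) (f k p.2) =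
      if j = k then inner ℂ p.1 p.2 else 0} := by
    split_ifs
    · exact isClosed_eq (by fun_prop) (by fun_prop)
    · exact isClosed_eq (by fun_prop) (by fun_prop)
  have hm : (v, w) ∈ closure (((fun a : H →L[ℂ] H => a Ω) '' N₀) ×ˢ
      ((fun a : H →L[ℂ] H => a Ω) '' N₀)) := by
    rw [closure_prod_eq]
    exact ⟨h.dense v hv, h.dense w hw⟩
  refine closure_minimal ?_ hcl hm
  rintro ⟨_, _⟩ ⟨⟨a, ha, rfl⟩, ⟨b, hb, rfl⟩⟩
  exact h.orth j hj k hk a ha b hb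

/-- The coordinate of a vector at `f k`. -/
def _root_.VonNeumannAlgebra.moduleCoord (N : VonNeumannAlgebra H) (Ω : H) (T : H →L[ℂ] H) :
    H →L[ℂ] N.L2 Ω :=
  (N.L2 Ω).orthogonalProjectionOnto ∘L ContinuousLinearMap.adjoint T

omit h in
theorem inner_moduleCoord (T : H →L[ℂ] H) (v : H) (w : N.L2 Ω) :
    inner ℂ (N.moduleCoord Ω T v) w = inner ℂ v (T w) := by
  rw [← ContinuousLinearMap.adjoint_inner_left]
  exact (Submodule.inner_orthogonalProjectionOnto_eq_of_mem_right w _)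

theorem moduleCoord_apply {j k : ℕ} (hj : j < n) (hk : k < n) (w : N.L2 Ω) :
    N.moduleCoord Ω (f j) (f k w) = if j = k then w else 0 := by
  refine ext_inner_right ℂ fun v => ?_
  rw [inner_moduleCoord, h.inner_eq hk hj w.2 v.2]
  by_cases hjk : j = k
  · simp [hjk]
  · simp [hjk, Ne.symm hjk]

/-- By adjunction this is the commutation of `f k` with `star T`, which again lies in `N`. -/
theorem moduleCoord_map {k : ℕ} (hk : k < n) {T : H →L[ℂ] H} (hT : T ∈ N) (v : H) :
    (N.moduleCoord Ω (f k) (T v) : H) = T (N.moduleCoord Ω (f k) v) := by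
  have : N.moduleCoord Ω (f k) (T v) =
      ⟨T (N.moduleCoord Ω (f k) v), map_mem_L2 hT (Subtype.prop _)⟩ := by
    refine ext_inner_right ℂ fun w => ?_
    have hs : star T ∈ N := star_mem hT
    rw [inner_moduleCoord, Submodule.coe_inner, ← ContinuousLinearMap.adjoint_inner_right,
      ← ContinuousLinearMap.star_eq_adjoint, ← h.commute k hk _ hs,
      ← ContinuousLinearMap.adjoint_inner_right, ← ContinuousLinearMap.star_eq_adjoint]
    exact (inner_moduleCoord (f k) v ⟨star T w, map_mem_L2 hs w.2⟩).symm
  exact congrArg Subtype.val this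

/-- The identity is a closed linear condition, and orthogonality verifies it on the spanning vectors
`f j (a Ω)`. -/
theorem sum_moduleCoord {v : H} (hv : v ∈ K) :
    ∑ k ∈ Finset.range n, f k (N.moduleCoord Ω (f k) v) = v := by
  have hcl : IsClosed {v | ∑ k ∈ Finset.range n, f k (N.moduleCoord Ω (f k) v) = v} :=
    isClosed_eq (by fun_prop) continuous_id
  refine closure_minimal ?_ hcl (h.span v hv)
  intro w hw
  induction hw using Submodule.span_induction with
  | zero => simp
  | add x y _ _ hx hy =>
    simp only [Set.mem_ofPred_eq] at hx hy ⊢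
    simp only [map_add, Submodule.coe_add, Finset.sum_add_distrib, hx, hy]
  | smul c x _ hx =>
    simp only [Set.mem_ofPred_eq] at hx ⊢
    simp only [map_smul, Submodule.coe_smul, ← Finset.smul_sum, hx]
  | mem x hx =>
    obtain ⟨j, hj, a, ha, rfl⟩ := hx
    simp only [Set.mem_ofPred_eq]
    rw [Finset.sum_eq_single j]
    · rw [h.moduleCoord_apply hj hj ⟨a Ω, h.apply_mem_L2 ha⟩, if_pos rfl]
    · intro k hk hkj
      rw [h.moduleCoord_apply (Finset.mem_range.1 hk) hj ⟨a Ω, h.apply_mem_L2 ha⟩, if_neg hkj]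
      simp
    · exact fun hj' => absurd (Finset.mem_range.2 hj) hj'

theorem norm_sq_eq {v : H} (hv : v ∈ K) :
    ‖v‖ ^ 2 = ∑ k ∈ Finset.range n, ‖N.moduleCoord Ω (f k) v‖ ^ 2 := by
  have : (inner ℂ v v : ℂ) = ∑ k ∈ Finset.range n,
      inner ℂ (N.moduleCoord Ω (f k) v) (N.moduleCoord Ω (f k) v) := by
    conv_lhs => rw [← h.sum_moduleCoord hv, inner_sum]
    refine Finset.sum_congr rfl fun k _ => ?_
    rw [inner_moduleCoord, h.sum_moduleCoord hv]
  simp only [inner_self_eq_norm_sq_to_K] at this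
  exact_mod_cast this

/-- The hypothesis says `q = J p` for the antiunitary conjugation `J : a Ω ↦ star a Ω` given by the
trace. Instead of constructing `J`, Cauchy–Schwarz bounds `⟪p, a Ω⟫` by `‖star a Ω‖ ‖q‖ = ‖a Ω‖
‖q‖`; by density `a Ω` may be replaced by `p`. -/
theorem norm_le_of_adjoint {p q : N.L2 Ω}
    (hpq : ∀ a ∈ N₀, inner ℂ (p : H) (a Ω) = inner ℂ (star a Ω) (q : H)) : ‖p‖ ≤ ‖q‖ := by
  have hcl : IsClosed {v : H | ‖(inner ℂ (p : H) v : ℂ)‖ ≤ ‖q‖ * ‖v‖} :=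
    isClosed_le (by fun_prop) (by fun_prop)
  have hp : ‖(inner ℂ (p : H) (p : H) : ℂ)‖ ≤ ‖q‖ * ‖(p : H)‖ := by
    refine closure_minimal ?_ hcl (h.dense p p.2)
    rintro _ ⟨a, ha, rfl⟩
    simp only [Set.mem_ofPred_eq]
    rw [hpq a ha, ← h.norm_star a ha, mul_comm]
    exact norm_inner_le_norm _ _
  rw [inner_self_eq_norm_sq_to_K, norm_pow, RCLike.norm_ofReal, abs_norm, sq] at hp
  rcases (norm_nonneg (p : H)).eq_or_lt with h0 | h0
  · exact (show ‖p‖ = ‖(p : H)‖ from rfl).trans h0.symm |>.le.trans (norm_nonneg _)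
  · exact le_of_mul_le_mul_right hp h0

theorem norm_eq_of_adjoint {p q : N.L2 Ω}
    (hpq : ∀ a ∈ N₀, inner ℂ (p : H) (a Ω) = inner ℂ (star a Ω) (q : H)) : ‖p‖ = ‖q‖ := by
  refine le_antisymm (h.norm_le_of_adjoint hpq) (h.norm_le_of_adjoint fun a ha => ?_)
  rw [← inner_conj_symm, ← inner_conj_symm (star a Ω), hpq _ (star_mem ha), star_star]

/-- The coordinates as an isometry into `L²(N) ⊗ ℓ²`. -/
def coordIsometry : K →ₗᵢ[ℂ] lp (fun _ : ℕ => N.L2 Ω) 2 where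
  toLinearMap := ∑ k ∈ Finset.range n, lp.lsingle (𝕜 := ℂ) (E := fun _ : ℕ => N.L2 Ω) 2 k ∘ₗ
    (N.moduleCoord Ω (f k)).toLinearMap ∘ₗ K.subtype
  norm_map' v := by
    have h1 := lp.norm_sum_single (p := 2) (E := fun _ : ℕ => N.L2 Ω) (by norm_num)
      (fun k => N.moduleCoord Ω (f k) v) (Finset.range n)
    simp only [ENNReal.toReal_ofNat, Real.rpow_ofNat] at h1
    rw [← h.norm_sq_eq v.2] at h1
    have h2 := (sq_eq_sq₀ (norm_nonneg _) (norm_nonneg _)).1 h1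
    change _ = ‖(v : H)‖
    rw [← h2, LinearMap.sum_apply]
    rfl

theorem coordIsometry_apply (v : K) (i : ℕ) :
    (h.coordIsometry v : ∀ _ : ℕ, N.L2 Ω) i =
      if i < n then N.moduleCoord Ω (f i) v else 0 := by
  have : h.coordIsometry v = ∑ k ∈ Finset.range n,
      lp.single (E := fun _ : ℕ => N.L2 Ω) 2 k (N.moduleCoord Ω (f k) v) := by
    change (∑ k ∈ Finset.range n, lp.lsingle (𝕜 := ℂ) (E := fun _ : ℕ => N.L2 Ω) 2 k ∘ₗ
      (N.moduleCoord Ω (f k)).toLinearMap ∘ₗ K.subtype) v = _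
    rw [LinearMap.sum_apply]
    rfl
  rw [this]
  simp only [lp.coeFn_single, lp.coeFn_sum, Finset.sum_apply, Finset.sum_pi_single,
    Finset.mem_range]

theorem isModuleEmbedding_coordIsometry : N.IsModuleEmbedding Ω K h.coordIsometry := by
  intro T hT ξ η hη i
  rw [coordIsometry_apply, coordIsometry_apply]
  split_ifs with hi
  · rw [hη, h.moduleCoord_map hi hT]
  · simp

/-- The two vectors are exchanged by the conjugation `a Ω ↦ star a Ω`: pairing the left one with `a
Ω` gives `⟪Ω, (u (f k (a Ω)))_i⟫ = ⟪star a Ω, (u (f k Ω))_i⟫`, by `N`-linearity of `u`. -/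
theorem norm_adjoint_single [CompleteSpace K] {u : K →ₗᵢ[ℂ] lp (fun _ : ℕ => N.L2 Ω) 2}
    (hu : N.IsModuleEmbedding Ω K u) (i : ℕ) {k : ℕ} (hk : k < n) :
    ‖N.moduleCoord Ω (f k) (ContinuousLinearMap.adjoint u.toContinuousLinearMap
        (lp.single 2 i (N.L2one Ω)))‖ =
      ‖(u ⟨f k Ω, h.mem_of_mem_L2 hk (N.L2one Ω).2⟩ : ∀ _ : ℕ, N.L2 Ω) i‖ := by
  refine h.norm_eq_of_adjoint fun a ha => ?_
  have haN := h.le a ha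
  have h1 := inner_moduleCoord (N := N) (Ω := Ω) (f k)
    (ContinuousLinearMap.adjoint u.toContinuousLinearMap (lp.single 2 i (N.L2one Ω)))
    ⟨a Ω, h.apply_mem_L2 ha⟩
  have h2 := ContinuousLinearMap.adjoint_inner_left u.toContinuousLinearMap
    ⟨f k (a Ω), h.mem k hk a ha⟩ (lp.single 2 i (N.L2one Ω))
  have h3 := lp.inner_single_left (𝕜 := ℂ) (G := fun _ : ℕ => N.L2 Ω) i (N.L2one Ω)
    (u ⟨f k (a Ω), h.mem k hk a ha⟩)
  have h4 := hu a haN ⟨f k Ω, h.mem_of_mem_L2 hk (N.L2one Ω).2⟩ ⟨f k (a Ω), h.mem k hk a ha⟩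
    (h.commute k hk a haN Ω) i
  refine (h1.trans (h2.trans h3)).trans ?_
  rw [Submodule.coe_inner, h4, ContinuousLinearMap.star_eq_adjoint,
    ContinuousLinearMap.adjoint_inner_left]
  rfl

/-- Expand `‖u* Ω_i‖²` in the free basis, turn each coordinate into `‖(u (f k Ω))_i‖²`, and exchange
the sums. Each `k` then contributes `‖u (f k Ω)‖² = ‖Ω‖² = 1`, whatever `u` is. -/
theorem sum_norm_adjoint_single [CompleteSpace K] {u : K →ₗᵢ[ℂ] lp (fun _ : ℕ => N.L2 Ω) 2}
    (hu : N.IsModuleEmbedding Ω K u) :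
    ∑' i : ℕ, ENNReal.ofReal (‖ContinuousLinearMap.adjoint u.toContinuousLinearMap
      (lp.single 2 i (N.L2one Ω))‖ ^ 2) = n := by
  let ξ : ∀ k, k < n → K := fun k hk => ⟨f k Ω, h.mem_of_mem_L2 hk (N.L2one Ω).2⟩
  have h1 : ∀ i : ℕ, ENNReal.ofReal (‖ContinuousLinearMap.adjoint u.toContinuousLinearMap
      (lp.single 2 i (N.L2one Ω))‖ ^ 2) =
      ∑ k : Fin n, ENNReal.ofReal (‖(u (ξ k k.2) : ∀ _ : ℕ, N.L2 Ω) i‖ ^ 2) := by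
    intro i
    rw [Submodule.coe_norm, h.norm_sq_eq (Subtype.prop _), Finset.sum_range,
      ENNReal.ofReal_sum_of_nonneg fun _ _ => by positivity]
    exact Finset.sum_congr rfl fun k _ => by rw [h.norm_adjoint_single hu i k.2]
  have h2 : ∀ k : Fin n,
      ∑' i : ℕ, ENNReal.ofReal (‖(u (ξ k k.2) : ∀ _ : ℕ, N.L2 Ω) i‖ ^ 2) = 1 := by
    intro k
    have hs := lp.hasSum_norm (p := 2) (by norm_num) (u (ξ k k.2))
    simp only [ENNReal.toReal_ofNat, Real.rpow_ofNat] at hs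
    rw [← ENNReal.ofReal_tsum_of_nonneg (fun _ => by positivity) hs.summable, hs.tsum_eq,
      u.norm_map, Submodule.coe_norm]
    have h3 := h.inner_eq k.2 k.2 (N.L2one Ω).2 (N.L2one Ω).2
    rw [if_pos rfl, inner_self_eq_norm_sq_to_K, inner_self_eq_norm_sq_to_K] at h3
    have h4 : ‖f k Ω‖ ^ 2 = ‖Ω‖ ^ 2 := by exact_mod_cast h3
    change ENNReal.ofReal (‖f k Ω‖ ^ 2) = 1
    rw [h4, h.norm_one]
    simp
  simp only [h1]
  rw [Summable.tsum_finsetSum fun _ _ => ENNReal.summable]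
  rw [Finset.sum_congr rfl fun k _ => h2 k]
  simp

/-- The infimum is over a constant function; the coordinate isometry shows that its index set is
nonempty, so that it is not `⊤`. -/
theorem mvnDim_eq [CompleteSpace K] : N.mvnDim Ω K = n := by
  have : Nonempty {u : K →ₗᵢ[ℂ] lp (fun _ : ℕ => N.L2 Ω) 2 // N.IsModuleEmbedding Ω K u} :=
    ⟨⟨h.coordIsometry, h.isModuleEmbedding_coordIsometry⟩⟩
  rw [mvnDim, iInf_congr fun u => h.sum_norm_adjoint_single u.2, iInf_const]

end IsFreeBasis

end VonNeumannAlgebra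

/-! ## Von Neumann algebras in the GNS representation of a tracial state -/

section GNS

variable {A : Type*} [CStarAlgebra A] [PartialOrder A] [StarOrderedRing A] {τ : A →ₚ[ℂ] ℂ}

theorem gnsStarAlgHom_gnsVector (a : A) :
    τ.gnsStarAlgHom a (gnsVector τ) = (τ.toPreGNS a : τ.GNS) := by
  simp [gnsVector]

theorem inner_gnsVector (a b : A) :
    inner ℂ (τ.gnsStarAlgHom a (gnsVector τ)) (τ.gnsStarAlgHom b (gnsVector τ)) =
      τ (star a * b) := by
  rw [gnsStarAlgHom_gnsVector, gnsStarAlgHom_gnsVector, UniformSpace.Completion.inner_coe]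
  rfl

theorem denseRange_gnsVector :
    DenseRange fun a : A => τ.gnsStarAlgHom a (gnsVector τ) := by
  simp only [gnsStarAlgHom_gnsVector]
  exact UniformSpace.Completion.denseRange_coe.comp τ.toPreGNS.surjective.denseRange
    (UniformSpace.Completion.continuous_coe _)

namespace IsTracialState

variable (hτ : IsTracialState τ)
include hτ

theorem norm_gnsVector : ‖gnsVector τ‖ = 1 := by
  have h : inner ℂ (gnsVector τ) (gnsVector τ) = (1 : ℂ) := by
    simpa [hτ.map_one] using inner_gnsVector (τ := τ) 1 1
  rw [inner_self_eq_norm_sq_to_K] at h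
  have h' : ‖gnsVector τ‖ ^ 2 = 1 := by
    rw [← RCLike.ofReal_pow] at h
    exact Complex.ofReal_eq_one.1 h
  exact (pow_eq_one_iff_of_nonneg (norm_nonneg _) two_ne_zero).1 h'

theorem norm_star_gnsVector (a : A) :
    ‖τ.gnsStarAlgHom (star a) (gnsVector τ)‖ = ‖τ.gnsStarAlgHom a (gnsVector τ)‖ := by
  rw [@norm_eq_sqrt_re_inner ℂ, @norm_eq_sqrt_re_inner ℂ, inner_gnsVector, inner_gnsVector,
    star_star, hτ.map_mul_comm]

/-- Right multiplication by `a`. -/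
def rightMulPreGNS (a : A) : τ.PreGNS →L[ℂ] τ.PreGNS :=
  LinearMap.mkContinuous
    (τ.toPreGNS.toLinearMap ∘ₗ LinearMap.mulRight ℂ a ∘ₗ τ.ofPreGNS.toLinearMap) ‖star a‖ fun x => by
    -- In the trace norm `star` is isometric, so right multiplication by `a` is as bounded as left
    -- multiplication by `star a`.
    have key : ∀ b : A, ‖τ.toPreGNS (star b)‖ = ‖τ.toPreGNS b‖ := fun b => by
      rw [PositiveLinearMap.preGNS_norm_def, PositiveLinearMap.preGNS_norm_def]
      simp only [PositiveLinearMap.ofPreGNS_toPreGNS, star_star, hτ.map_mul_comm b]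
    have := (τ.leftMulMapPreGNS (star a)).le_of_opNorm_le
      (LinearMap.mkContinuous_norm_le _ (norm_nonneg _) _) (τ.toPreGNS (star (τ.ofPreGNS x)))
    rw [key] at this
    refine le_trans (le_of_eq ?_) this
    rw [PositiveLinearMap.leftMulMapPreGNS_apply]
    change ‖τ.toPreGNS (τ.ofPreGNS x * a)‖ = ‖τ.toPreGNS (star a * star (τ.ofPreGNS x))‖
    rw [← key, star_mul]

/-- Right multiplication by `a` on the GNS space of a tracial state. -/
def rightMul (a : A) : τ.GNS →L[ℂ] τ.GNS := (hτ.rightMulPreGNS a).completion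

theorem rightMul_apply (a b : A) :
    hτ.rightMul a (τ.gnsStarAlgHom b (gnsVector τ)) = τ.gnsStarAlgHom (b * a) (gnsVector τ) := by
  rw [gnsStarAlgHom_gnsVector, gnsStarAlgHom_gnsVector, rightMul]
  simp only [ContinuousLinearMap.completion_apply_coe]
  rfl

theorem rightMul_gnsVector (a : A) :
    hτ.rightMul a (gnsVector τ) = τ.gnsStarAlgHom a (gnsVector τ) := by
  simpa using hτ.rightMul_apply a 1

theorem rightMul_commute (a b : A) :
    τ.gnsStarAlgHom b * hτ.rightMul a = hτ.rightMul a * τ.gnsStarAlgHom b := by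
  refine ContinuousLinearMap.ext fun v => congrFun (denseRange_gnsVector.equalizer
    (ContinuousLinearMap.continuous _) (ContinuousLinearMap.continuous _) (funext fun c => ?_)) v
  simp only [Function.comp_apply, mul_apply_eq_comp, hτ.rightMul_apply]
  rw [← mul_apply_eq_comp, ← map_mul, ← mul_assoc, ← hτ.rightMul_apply, map_mul, mul_apply_eq_comp]

theorem inner_rightMul (a b : A) (v : τ.GNS) :
    inner ℂ v (hτ.rightMul a (τ.gnsStarAlgHom b (gnsVector τ))) =
      inner ℂ (hτ.rightMul (star a) v) (τ.gnsStarAlgHom b (gnsVector τ)) := by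
  refine congrFun (denseRange_gnsVector.equalizer
    (g := fun v => inner ℂ v (hτ.rightMul a (τ.gnsStarAlgHom b (gnsVector τ))))
    (h := fun v => inner ℂ (hτ.rightMul (star a) v) (τ.gnsStarAlgHom b (gnsVector τ)))
    (by fun_prop) (by fun_prop) (funext fun c => ?_)) v
  simp only [Function.comp_apply]
  rw [hτ.rightMul_apply, hτ.rightMul_apply, inner_gnsVector, inner_gnsVector, star_mul, star_star,
    ← mul_assoc, hτ.map_mul_comm, mul_assoc]

end IsTracialState

/-- The von Neumann algebra generated by a star subalgebra in the GNS representation. -/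
def gnsVN (τ : A →ₚ[ℂ] ℂ) (B : StarSubalgebra ℂ A) : VonNeumannAlgebra τ.GNS :=
  VonNeumannAlgebra.generated (τ.gnsStarAlgHom '' (B : Set A))

variable {B : StarSubalgebra ℂ A}

theorem mem_gnsVN_iff {T : τ.GNS →L[ℂ] τ.GNS} : T ∈ gnsVN τ B ↔
    ∀ X : τ.GNS →L[ℂ] τ.GNS, (∀ b ∈ B, τ.gnsStarAlgHom b * X = X * τ.gnsStarAlgHom b) →
      X * T = T * X := by
  have h1 : ∀ X : τ.GNS →L[ℂ] τ.GNS,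
      X ∈ StarSubalgebra.centralizer ℂ (τ.gnsStarAlgHom '' (B : Set A)) ↔
        ∀ b ∈ B, τ.gnsStarAlgHom b * X = X * τ.gnsStarAlgHom b := by
    intro X
    rw [StarSubalgebra.mem_centralizer_iff]
    constructor
    · exact fun h b hb => (h _ ⟨b, hb, rfl⟩).1
    · rintro h _ ⟨b, hb, rfl⟩
      exact ⟨h b hb, by rw [← map_star]; exact h _ (star_mem hb)⟩
  change T ∈ StarSubalgebra.centralizer ℂ (StarSubalgebra.centralizer ℂ
    (τ.gnsStarAlgHom '' (B : Set A)) : Set (τ.GNS →L[ℂ] τ.GNS)) ↔ _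
  rw [StarSubalgebra.mem_centralizer_iff]
  constructor
  · exact fun h X hX => (h X ((h1 X).2 hX)).1
  · exact fun h X hX => ⟨h X ((h1 X).1 hX), h _ ((h1 _).1 (star_mem hX))⟩

theorem gnsStarAlgHom_mem_gnsVN {b : A} (hb : b ∈ B) : τ.gnsStarAlgHom b ∈ gnsVN τ B :=
  mem_gnsVN_iff.2 fun _ hX => (hX b hb).symm

/-- The linear map `a ↦ a Ω`. -/
def gnsVec (τ : A →ₚ[ℂ] ℂ) : A →ₗ[ℂ] τ.GNS :=
  (ContinuousLinearMap.apply ℂ τ.GNS (gnsVector τ) :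
    (τ.GNS →L[ℂ] τ.GNS) →L[ℂ] τ.GNS).toLinearMap ∘ₗ τ.gnsStarAlgHom.toAlgHom.toLinearMap

/-- The subspace `B Ω`. -/
def gnsOrbit (τ : A →ₚ[ℂ] ℂ) (B : StarSubalgebra ℂ A) : Submodule ℂ τ.GNS :=
  Submodule.map (gnsVec τ) B.toSubalgebra.toSubmodule

/-- The projection `P` onto the closure of `B Ω` commutes with `B`, hence with every `T` in the
bicommutant, and `T Ω = T P Ω = P T Ω`. Passing to the von Neumann algebra thus does not enlarge the
standard space. -/
theorem L2_gnsVN : (gnsVN τ B).L2 (gnsVector τ) = (gnsOrbit τ B).topologicalClosure := by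
  apply le_antisymm
  · set W := (gnsOrbit τ B).topologicalClosure with hW
    have : CompleteSpace W := (Submodule.isClosed_topologicalClosure _).completeSpace_coe
    have hinv : ∀ b ∈ B, ∀ v ∈ W, τ.gnsStarAlgHom b v ∈ W := by
      intro b hb v hv
      refine map_mem_closure (τ.gnsStarAlgHom b).continuous (s := _) (t := _) hv ?_
      rintro _ ⟨c, hc, rfl⟩
      refine ⟨b * c, mul_mem (S := StarSubalgebra ℂ A) hb hc, ?_⟩
      change τ.gnsStarAlgHom (b * c) (gnsVector τ) =
        τ.gnsStarAlgHom b (τ.gnsStarAlgHom c (gnsVector τ))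
      rw [map_mul, mul_apply_eq_comp]
    have hP : ∀ b ∈ B, τ.gnsStarAlgHom b * W.starProjection =
        W.starProjection * τ.gnsStarAlgHom b := by
      intro b hb
      refine ContinuousLinearMap.ext fun v => ?_
      rw [mul_apply_eq_comp, mul_apply_eq_comp]
      refine (Submodule.eq_starProjection_of_mem_orthogonal (hinv b hb _ ?_) ?_).symm
      · exact Submodule.starProjection_apply_mem _ _
      · rw [← map_sub, Submodule.mem_orthogonal]
        intro w hw
        rw [← ContinuousLinearMap.adjoint_inner_left, ← ContinuousLinearMap.star_eq_adjoint,
          ← map_star]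
        exact Submodule.inner_right_of_mem_orthogonal (hinv _ (star_mem hb) w hw)
          (Submodule.sub_starProjection_mem_orthogonal v)
    refine Submodule.topologicalClosure_minimal _ ?_ (Submodule.isClosed_topologicalClosure _)
    rintro _ ⟨T, hT, rfl⟩
    change T (gnsVector τ) ∈ W
    have hΩ : gnsVector τ ∈ W := Submodule.le_topologicalClosure _ ⟨1, one_mem B, by
      change τ.gnsStarAlgHom 1 (gnsVector τ) = _
      simp⟩
    have h1 := DFunLike.congr_fun (mem_gnsVN_iff.1 hT _ hP) (gnsVector τ)
    rw [mul_apply_eq_comp, mul_apply_eq_comp, Submodule.starProjection_eq_self_iff.2 hΩ] at h1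
    rw [← h1]
    exact Submodule.starProjection_apply_mem _ _
  · refine Submodule.topologicalClosure_mono ?_
    rintro _ ⟨b, hb, rfl⟩
    exact ⟨_, gnsStarAlgHom_mem_gnsVN hb, rfl⟩

theorem mem_conj_iff {H : Type*} [NormedAddCommGroup H] [InnerProductSpace ℂ H] [CompleteSpace H]
    {U : H ≃ₗᵢ[ℂ] H} {M : VonNeumannAlgebra H} {T : H →L[ℂ] H} :
    T ∈ VonNeumannAlgebra.conj U M ↔ U.conjStarAlgEquiv.symm T ∈ M := by
  constructor
  · rintro ⟨S, hS, rfl⟩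
    have : U.conjStarAlgEquiv.symm (U.conjStarAlgEquiv S) = S := StarAlgEquiv.symm_apply_apply _ S
    exact this.symm ▸ hS
  · exact fun h => ⟨_, h, StarAlgEquiv.apply_symm_apply U.conjStarAlgEquiv T⟩

theorem conj_gnsVN (hτ : IsUniqueTracialState τ) (α : A ≃⋆ₐ[ℂ] A) :
    (gnsVN τ B).conj (gnsUnitary hτ α) = gnsVN τ (B.map α.toStarAlgHom) := by
  ext T
  rw [mem_conj_iff, mem_gnsVN_iff, mem_gnsVN_iff]
  set Φ := (gnsUnitary hτ α).conjStarAlgEquiv with hΦ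
  have hinj : Function.Injective Φ := EquivLike.injective Φ
  have e : ∀ X, Φ (Φ.symm X) = X := StarAlgEquiv.apply_symm_apply _
  constructor
  · intro h X hX
    have := h (Φ.symm X) fun b hb => hinj (by
      rw [map_mul Φ, map_mul Φ, e, hΦ, gnsUnitary_conj]
      exact hX _ ⟨b, hb, rfl⟩)
    have := congrArg Φ this
    rwa [map_mul Φ, map_mul Φ, e, e] at this
  · intro h X hX
    apply hinj
    rw [map_mul Φ, map_mul Φ, e]
    refine h _ ?_
    rintro _ ⟨b, hb, rfl⟩
    have := congrArg Φ (hX b hb)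
    rw [map_mul Φ, map_mul Φ, hΦ, gnsUnitary_conj] at this
    exact this

/-- For central `T`, the functional `a ↦ ⟪T Ω, a Ω⟫` is tracial on `B`, so by hypothesis it is a
multiple of `τ`. This forces `T Ω` to be a multiple of `Ω`, and `T` commutes with right
multiplications, which move `Ω` to a dense set. -/
theorem IsTracialState.isFactor_gnsVN (hτ : IsTracialState τ)
    (hB : ∀ φ : A →ₗ[ℂ] ℂ, (∀ a ∈ B, ∀ b ∈ B, φ (a * b) = φ (b * a)) →
      ∀ a ∈ B, φ a = φ 1 * τ a) : (gnsVN τ B).IsFactor := by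
  intro T hT hT'
  rw [VonNeumannAlgebra.mem_commutant_iff] at hT'
  set Ω := gnsVector τ with hΩ
  have hTR : ∀ a v, T (hτ.rightMul a v) = hτ.rightMul a (T v) := fun a v =>
    (DFunLike.congr_fun (mem_gnsVN_iff.1 hT _ fun b _ => hτ.rightMul_commute a b) v).symm
  -- Left and right multiplication by `b` agree on `Ω`, and `T` commutes with both.
  have hTπ : ∀ b ∈ B, τ.gnsStarAlgHom b (T Ω) = hτ.rightMul b (T Ω) := by
    intro b hb
    rw [← hTR, hτ.rightMul_gnsVector]
    exact DFunLike.congr_fun (hT' _ (gnsStarAlgHom_mem_gnsVN hb)) Ω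
  let φ : A →ₗ[ℂ] ℂ := (innerₛₗ ℂ (T Ω)) ∘ₗ (ContinuousLinearMap.apply ℂ τ.GNS Ω :
    (τ.GNS →L[ℂ] τ.GNS) →L[ℂ] τ.GNS).toLinearMap ∘ₗ τ.gnsStarAlgHom.toAlgHom.toLinearMap
  have hφ : ∀ a, φ a = inner ℂ (T Ω) (τ.gnsStarAlgHom a Ω) := fun _ => rfl
  have htr : ∀ a ∈ B, ∀ b ∈ B, φ (a * b) = φ (b * a) := by
    intro a _ b hb
    rw [hφ, hφ, ← hτ.rightMul_apply, hτ.inner_rightMul, ← hTπ _ (star_mem hb), map_star,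
      ContinuousLinearMap.star_eq_adjoint, ContinuousLinearMap.adjoint_inner_left, map_mul,
      mul_apply_eq_comp]
  have h1 := hB φ htr
  set c : ℂ := inner ℂ Ω (T Ω) with hc
  -- This vector lies in `L²` of the algebra and, by the next step, is orthogonal to it.
  have hmem : T Ω - c • Ω ∈ (gnsVN τ B).L2 Ω := by
    refine sub_mem (Submodule.le_topologicalClosure _ ⟨T, hT, rfl⟩) (Submodule.smul_mem _ _ ?_)
    exact ((gnsVN τ B).L2one Ω).2
  have horth : ∀ w ∈ (gnsVN τ B).L2 Ω, (inner ℂ (T Ω - c • Ω) w : ℂ) = 0 := by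
    intro w hw
    rw [L2_gnsVN] at hw
    refine closure_minimal (t := {w | (inner ℂ (T Ω - c • Ω) w : ℂ) = 0}) ?_
      (isClosed_eq (by fun_prop) continuous_const) hw
    rintro _ ⟨b, hb, rfl⟩
    change inner ℂ (T Ω - c • Ω) (τ.gnsStarAlgHom b Ω) = (0 : ℂ)
    have h2 : inner ℂ Ω (τ.gnsStarAlgHom b Ω) = τ b := by
      simpa using inner_gnsVector (τ := τ) 1 b
    have h3 : φ 1 = (starRingEnd ℂ) c := by
      rw [hφ, _root_.map_one τ.gnsStarAlgHom, hc, inner_conj_symm]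
      rfl
    rw [inner_sub_left, inner_smul_left, h2, ← hφ, h1 b hb, h3, sub_self]
  have hTΩ : T Ω = c • Ω := sub_eq_zero.1 (inner_self_eq_zero.1 (horth _ hmem))
  refine ⟨c, ContinuousLinearMap.ext fun v => congrFun (denseRange_gnsVector.equalizer
    T.continuous (ContinuousLinearMap.continuous _) (funext fun b => ?_)) v⟩
  simp only [Function.comp_apply, _root_.smul_apply, one_apply_eq_self]
  rw [← hτ.rightMul_gnsVector, hTR, ← hΩ, hTΩ, map_smul]

/-! ### The Jones index of a tensor product with a finite-dimensional algebra. -/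

theorem gnsVec_apply (a : A) : gnsVec τ a = τ.gnsStarAlgHom a (gnsVector τ) := rfl

/-- Faithfulness embeds `F` into the GNS space, from which an orthonormal basis is pulled back. -/
theorem exists_orthonormal_gnsVec {F : StarSubalgebra ℂ A} [Module.Finite ℂ F]
    (hF : ∀ f ∈ F, τ (star f * f) = 0 → f = 0) :
    ∃ g : ℕ → A, (∀ k, g k ∈ F) ∧
      (∀ j < Module.finrank ℂ F, ∀ k < Module.finrank ℂ F,
        τ (star (g j) * g k) = if j = k then 1 else 0) ∧
      ∀ f ∈ F, f ∈ Submodule.span ℂ (g '' Set.Iio (Module.finrank ℂ F)) := by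
  let L : F →ₗ[ℂ] τ.GNS := gnsVec τ ∘ₗ (F.subtype.toAlgHom.toLinearMap : F →ₗ[ℂ] A)
  have hL : ∀ f : F, L f = τ.gnsStarAlgHom f (gnsVector τ) := fun _ => rfl
  have hinj : Function.Injective L := by
    refine (injective_iff_map_eq_zero L).2 fun f hf => Subtype.ext (hF _ f.2 ?_)
    rw [← inner_gnsVector, ← hL, hf, inner_zero_left]
  let e := LinearEquiv.ofInjective L hinj
  have hfin : FiniteDimensional ℂ L.range := Module.Finite.equiv e
  have hrank : Module.finrank ℂ L.range = Module.finrank ℂ F := e.finrank_eq.symm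
  let b := (stdOrthonormalBasis ℂ L.range).reindex (finCongr hrank)
  -- The value `0` beyond the dimension is a filler; `IsFreeBasis` only looks at indices below `n`.
  let g : ℕ → A := fun k => if hk : k < Module.finrank ℂ F then (e.symm (b ⟨k, hk⟩)).1 else 0
  have hg : ∀ k (hk : k < Module.finrank ℂ F), g k = (e.symm (b ⟨k, hk⟩)).1 :=
    fun k hk => dif_pos hk
  have hge : ∀ k (hk : k < Module.finrank ℂ F),
      τ.gnsStarAlgHom (g k) (gnsVector τ) = b ⟨k, hk⟩ := by
    intro k hk
    rw [hg k hk, ← hL]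
    exact congrArg Subtype.val (e.apply_symm_apply (b ⟨k, hk⟩))
  refine ⟨g, fun k => ?_, fun j hj k hk => ?_, fun f hf => ?_⟩
  · by_cases hk : k < Module.finrank ℂ F
    · exact hg k hk ▸ (e.symm (b ⟨k, hk⟩)).2
    · simp only [g, dif_neg hk]
      exact zero_mem F
  · rw [← inner_gnsVector, hge j hj, hge k hk, ← Submodule.coe_inner,
      orthonormal_iff_ite.1 b.orthonormal]
    simp
  · have h1 := b.sum_repr (e ⟨f, hf⟩)
    have h2 := congrArg e.symm h1
    rw [map_sum, LinearEquiv.symm_apply_apply] at h2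
    have h3 : f = ∑ k : Fin (Module.finrank ℂ F), b.repr (e ⟨f, hf⟩) k • g k := by
      have h4 := congrArg Subtype.val h2
      refine h4.symm.trans ?_
      change F.subtype.toAlgHom.toLinearMap _ = _
      rw [map_sum]
      refine Finset.sum_congr rfl fun k _ => ?_
      rw [map_smul, map_smul, hg k k.2]
      rfl
    rw [h3]
    exact sum_mem fun k _ => Submodule.smul_mem _ _ (Submodule.subset_span ⟨k, k.2, rfl⟩)

/-- The Jones index of `N₀ ⊗ F ⊇ N₀`, for a finite-dimensional algebra `F`. -/
theorem IsTracialState.jonesIndex_gnsVN (hτ : IsTracialState τ) {N₀ F : StarSubalgebra ℂ A}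
    [Module.Finite ℂ F] (hN : N₀ ≤ B) (hF : F ≤ B) (hcomm : ∀ a ∈ N₀, ∀ f ∈ F, Commute a f)
    (hprod : ∀ a ∈ N₀, ∀ f ∈ F, τ (a * f) = τ a * τ f)
    (hfaith : ∀ f ∈ F, τ (star f * f) = 0 → f = 0)
    (hspan : ∀ b ∈ B, b ∈ Submodule.span ℂ {x | ∃ f ∈ F, ∃ a ∈ N₀, x = f * a}) :
    (gnsVN τ B).jonesIndex (gnsVN τ N₀) (gnsVector τ) = Module.finrank ℂ F := by
  obtain ⟨g, hgF, hgo, hgs⟩ := exists_orthonormal_gnsVec hfaith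
  have happ : ∀ a b : A, τ.gnsStarAlgHom a (τ.gnsStarAlgHom b (gnsVector τ)) =
      gnsVec τ (a * b) := fun a b => by
    rw [gnsVec_apply, map_mul τ.gnsStarAlgHom, mul_apply_eq_comp]
  refine VonNeumannAlgebra.IsFreeBasis.mvnDim_eq (N₀ := N₀.map τ.gnsStarAlgHom)
    (f := fun k => τ.gnsStarAlgHom (g k)) ⟨hτ.norm_gnsVector, ?_, ?_, ?_, ?_, ?_, ?_, ?_, ?_⟩
  · rintro _ ⟨a, ha, rfl⟩
    exact gnsStarAlgHom_mem_gnsVN ha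
  · rintro _ ⟨a, ha, rfl⟩
    exact (congrArg (fun T : τ.GNS →L[ℂ] τ.GNS => ‖T (gnsVector τ)‖)
      (map_star τ.gnsStarAlgHom a).symm).trans (hτ.norm_star_gnsVector a)
  · intro v hv
    rw [L2_gnsVN] at hv
    refine closure_mono ?_ hv
    rintro _ ⟨a, ha, rfl⟩
    exact ⟨_, ⟨a, ha, rfl⟩, rfl⟩
  · intro k _ T hT v
    exact DFunLike.congr_fun (mem_gnsVN_iff.1 hT (τ.gnsStarAlgHom (g k)) fun a ha => by
      rw [← map_mul τ.gnsStarAlgHom, (hcomm a ha _ (hgF k)).eq, map_mul τ.gnsStarAlgHom]) v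
  · rintro j hj k hk _ ⟨a, ha, rfl⟩ _ ⟨b, hb, rfl⟩
    change inner ℂ (τ.gnsStarAlgHom (g j) (τ.gnsStarAlgHom a (gnsVector τ)))
      (τ.gnsStarAlgHom (g k) (τ.gnsStarAlgHom b (gnsVector τ))) =
      if j = k then inner ℂ (τ.gnsStarAlgHom a (gnsVector τ))
        (τ.gnsStarAlgHom b (gnsVector τ)) else 0
    rw [happ, happ, gnsVec_apply, gnsVec_apply, inner_gnsVector, inner_gnsVector]
    -- Collecting the `N₀` factors on the left lets the product formula for `τ` separate them from
    -- those in `F`.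
    have e : star (g j * a) * (g k * b) = star a * b * (star (g j) * g k) := by
      have h1 : Commute b (star (g j) * g k) := hcomm b hb _ (mul_mem (star_mem (hgF j)) (hgF k))
      rw [star_mul, mul_assoc, ← mul_assoc (star (g j)), ← h1.eq, mul_assoc]
    rw [e, hprod _ (mul_mem (star_mem ha) hb) _ (mul_mem (star_mem (hgF j)) (hgF k)),
      hgo j hj k hk]
    simp
  · rintro k _ _ ⟨a, ha, rfl⟩
    rw [L2_gnsVN]
    refine Submodule.le_topologicalClosure _
      ⟨g k * a, mul_mem (S := StarSubalgebra ℂ A) (hF (hgF k)) (hN ha), ?_⟩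
    exact (happ _ _).symm
  · exact Submodule.isClosed_topologicalClosure _
  · intro v hv
    rw [L2_gnsVN] at hv
    refine closure_mono ?_ hv
    rintro _ ⟨b, hb, rfl⟩
    have hle : Submodule.span ℂ {x | ∃ f ∈ F, ∃ a ∈ N₀, x = f * a} ≤
        (Submodule.span ℂ {w | ∃ k < Module.finrank ℂ F, ∃ a ∈ N₀.map τ.gnsStarAlgHom,
          w = τ.gnsStarAlgHom (g k) (a (gnsVector τ))}).comap (gnsVec τ) := by
      rw [Submodule.span_le]
      rintro _ ⟨f, hf, a, ha, rfl⟩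
      have h1 := Submodule.mem_map_of_mem (f := gnsVec τ ∘ₗ LinearMap.mulRight ℂ a) (hgs f hf)
      rw [Submodule.map_span] at h1
      refine Submodule.span_mono ?_ h1
      rintro _ ⟨_, ⟨k, hk, rfl⟩, rfl⟩
      exact ⟨k, hk, _, ⟨a, ha, rfl⟩, (happ _ _).symm⟩
    exact hle (hspan b hb)

end GNS

/-! ## The index of a quantum cellular automaton -/

section QCAIndex

open Matrix

attribute [local irreducible] instCStarAlgebraQuasiLocal

variable {d : ℕ} {α : QuasiLocal d ≃⋆ₐ[ℂ] QuasiLocal d} {l : ℕ}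

theorem AbstractSpinChain.HasSpreadLE.map_mem (hα : (quditChain d).HasSpreadLE α l) {u v : ℤ}
    {a : QuasiLocal d} (ha : a ∈ siteAlg d (Finset.Ioc u v)) :
    α a ∈ siteAlg d (Finset.Ioc (u - l) (v + l)) := by
  by_cases huv : u < v
  · have e1 : Finset.Ioc u v = Finset.Icc (u + 1) v := by ext n; simp
    have e2 : Finset.Ioc (u - l) (v + l) = Finset.Icc (u + 1 - l) (v + l) := by
      ext n
      simp only [Finset.mem_Ioc, Finset.mem_Icc]
      omega
    rw [e1] at ha
    rw [e2]
    exact (hα ⟨(u + 1, v), huv⟩ a ha).1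
  · rw [Finset.Ioc_eq_empty huv, siteAlg_empty] at ha
    obtain ⟨c, rfl⟩ := ha
    exact (AlgHomClass.commutes α c).symm ▸ algebraMap_mem (siteAlg d _) c

theorem AbstractSpinChain.HasSpreadLE.symm (hα : (quditChain d).HasSpreadLE α l) :
    (quditChain d).HasSpreadLE α.symm l := fun I a ha => (hα I a ha).symm

theorem AbstractSpinChain.HasSpreadLE.map_mem_leftLoc (hα : (quditChain d).HasSpreadLE α l) {x : ℤ}
    {a : QuasiLocal d} (ha : a ∈ leftLoc d x) : α a ∈ leftLoc d (x + l) := by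
  obtain ⟨w, hw⟩ := ha
  exact ⟨_, hα.map_mem hw⟩

theorem hasSpreadLE_refl : (quditChain d).HasSpreadLE (StarAlgEquiv.refl ℂ (QuasiLocal d)) 0 := by
  intro I a ha
  have : I.enlarge 0 = I := by simp [NonemptyInterval.enlarge]
  rw [this]
  exact ⟨ha, ha⟩

/-- The image under `α` of the algebra of the local operators on the sites `≤ x`. -/
def imageLoc (α : QuasiLocal d ≃⋆ₐ[ℂ] QuasiLocal d) (x : ℤ) : StarSubalgebra ℂ (QuasiLocal d) :=
  (leftLoc d x).map α.toStarAlgHom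

theorem mem_imageLoc {x : ℤ} {a : QuasiLocal d} : a ∈ imageLoc α x ↔ α.symm a ∈ leftLoc d x := by
  constructor
  · rintro ⟨b, hb, rfl⟩
    exact (StarAlgEquiv.symm_apply_apply α b).symm ▸ hb
  · exact fun h => ⟨_, h, StarAlgEquiv.apply_symm_apply α a⟩

theorem imageLoc_mono {x x' : ℤ} (h : x ≤ x') : imageLoc α x ≤ imageLoc α x' :=
  StarSubalgebra.map_mono (leftLoc_mono h)

theorem imageLoc_refl (x : ℤ) : imageLoc (StarAlgEquiv.refl ℂ (QuasiLocal d)) x = leftLoc d x := by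
  ext a
  rw [mem_imageLoc]
  rfl

theorem imageLoc_le (hα : (quditChain d).HasSpreadLE α l) (x : ℤ) :
    imageLoc α x ≤ leftLoc d (x + l) := by
  rintro _ ⟨b, hb, rfl⟩
  exact hα.map_mem_leftLoc hb

theorem leftLoc_le_imageLoc (hα : (quditChain d).HasSpreadLE α l) (x : ℤ) :
    leftLoc d (x - l) ≤ imageLoc α x := fun a ha => by
  rw [mem_imageLoc]
  simpa using hα.symm.map_mem_leftLoc ha

/-- The relative commutant of `leftLoc d y` in the image of `leftLoc d x`. -/
def relComm (α : QuasiLocal d ≃⋆ₐ[ℂ] QuasiLocal d) (x y : ℤ) : StarSubalgebra ℂ (QuasiLocal d) :=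
  imageLoc α x ⊓ StarSubalgebra.centralizer ℂ (leftLoc d y : Set (QuasiLocal d))

theorem mem_relComm {x y : ℤ} {a : QuasiLocal d} :
    a ∈ relComm α x y ↔ a ∈ imageLoc α x ∧ ∀ b ∈ leftLoc d y, Commute b a := by
  rw [relComm, StarSubalgebra.mem_inf, StarSubalgebra.mem_centralizer_iff]
  refine and_congr_right fun _ => ⟨fun h b hb => (h b hb).1, fun h b hb => ⟨h b hb, ?_⟩⟩
  exact h _ (star_mem hb)

theorem relComm_mono {x x' y y' : ℤ} (hx : x ≤ x') (hy : y' ≤ y) :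
    relComm α x y ≤ relComm α x' y' := fun a ha => by
  rw [mem_relComm] at ha ⊢
  exact ⟨imageLoc_mono hx ha.1, fun b hb => ha.2 b (leftLoc_mono hy hb)⟩

variable [NeZero d]

/-- Finite spread bounds the support on the right by `x + l`, and commuting with `leftLoc d y`
bounds it on the left by `y`. Finite dimension follows. -/
theorem relComm_le (hα : (quditChain d).HasSpreadLE α l) {x y : ℤ} (hy : y ≤ x + l) :
    relComm α x y ≤ siteAlg d (Finset.Ioc y (x + l)) := fun a ha => by
  rw [mem_relComm] at ha
  exact mem_siteAlg_of_mem_leftLoc hy (imageLoc_le hα x ha.1) ha.2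

theorem relComm_refl {x y : ℤ} (h : y ≤ x) :
    relComm (StarAlgEquiv.refl ℂ (QuasiLocal d)) x y = siteAlg d (Finset.Ioc y x) := by
  apply le_antisymm
  · simpa using relComm_le (d := d) hasSpreadLE_refl (x := x) (y := y) (by simpa using h)
  · intro a ha
    rw [mem_relComm, imageLoc_refl]
    exact ⟨siteAlg_le_leftLoc _ _ ha, fun b hb => commute_leftLoc hb ha⟩

theorem finite_relComm (hα : (quditChain d).HasSpreadLE α l) {x y : ℤ} (hy : y ≤ x + l) :
    Module.Finite ℂ (relComm α x y) :=
  Module.Finite.of_injective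
    ((StarSubalgebra.inclusion (relComm_le hα hy)).toAlgHom.toLinearMap :
      relComm α x y →ₗ[ℂ] siteAlg d (Finset.Ioc y (x + l)))
    (StarSubalgebra.inclusion_injective (relComm_le hα hy))

-- A coefficient at the matrix units of `(w, y]` is supported in `(y, z]`, so it commutes with
-- `leftLoc d y`. It also stays in `imageLoc α x`, since the matrix units lie there by `hle`.
omit [NeZero d] in
theorem unitCoeff_mem_relComm {x y w z : ℤ} (hle : leftLoc d y ≤ imageLoc α x) (hw : w ≤ y)
    (hz : y ≤ z) {a : QuasiLocal d} (ha : a ∈ imageLoc α x) (haz : a ∈ siteAlg d (Finset.Ioc w z))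
    (u v) : unitCoeff (siteHom d (Finset.Ioc w y)) u v a ∈ relComm α x y := by
  have h1 : unitCoeff (siteHom d (Finset.Ioc w y)) u v a ∈ siteAlg d (Finset.Ioc y z) := by
    rw [← Ioc_union hw hz, siteAlg_union (disjoint_Ioc _ _ _)] at haz
    exact (mem_sup_range_iff _ fun s hs M =>
      commute_of_disjoint (disjoint_Ioc w y z) (siteHom_mem _ _) hs).1 haz u v
  rw [mem_relComm]
  refine ⟨?_, fun b hb => commute_leftLoc hb h1⟩
  have h2 : ∀ M, siteHom d (Finset.Ioc w y) M ∈ imageLoc α x := fun M =>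
    hle (siteAlg_le_leftLoc _ _ (siteHom_mem _ _))
  exact sum_mem fun k _ => mul_mem (mul_mem (h2 _) ha) (h2 _)

omit [NeZero d] in
theorem mem_relComm_sup {x y w z : ℤ} (hle : leftLoc d y ≤ imageLoc α x) (hw : w ≤ y)
    (hz : y ≤ z) {a : QuasiLocal d} (ha : a ∈ imageLoc α x)
    (haz : a ∈ siteAlg d (Finset.Ioc w z)) :
    a ∈ relComm α x y ⊔ siteAlg d (Finset.Ioc w y) :=
  (mem_sup_range_iff _ fun _ hs M => (mem_relComm.1 hs).2 _
    (siteAlg_le_leftLoc _ _ (siteHom_mem _ M))).2 (unitCoeff_mem_relComm hle hw hz ha haz)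

omit [NeZero d] in
theorem card_config_Ioc (w y : ℤ) :
    Fintype.card (Finset.Ioc w y → Fin d) = d ^ (y - w).toNat := by
  simp

theorem relComm_eq_sup_left (hα : (quditChain d).HasSpreadLE α l) {x y y' : ℤ} (hyx : y ≤ x)
    (hle : leftLoc d y ≤ imageLoc α x) (hy : y' ≤ y) :
    relComm α x y' = relComm α x y ⊔ siteAlg d (Finset.Ioc y' y) := by
  apply le_antisymm
  · intro a ha
    exact mem_relComm_sup hle hy (by omega) (mem_relComm.1 ha).1 (relComm_le hα (by omega) ha)
  · refine sup_le (relComm_mono le_rfl hy) fun a ha => ?_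
    exact mem_relComm.2 ⟨hle (siteAlg_le_leftLoc _ _ ha), fun b hb => commute_leftLoc hb ha⟩

theorem finrank_relComm_left (hα : (quditChain d).HasSpreadLE α l) {x y y' : ℤ} (hyx : y ≤ x)
    (hle : leftLoc d y ≤ imageLoc α x) (hy : y' ≤ y) :
    Module.finrank ℂ (relComm α x y') =
      d ^ (2 * (y - y').toNat) * Module.finrank ℂ (relComm α x y) := by
  rw [relComm_eq_sup_left hα hyx hle hy, siteAlg, finrank_sup_range, card_config_Ioc, ← pow_mul,
    mul_comm 2]
  exact fun s hs M => (mem_relComm.1 hs).2 _ (siteAlg_le_leftLoc _ _ (siteHom_mem _ M))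

omit [NeZero d] in
theorem commute_image_siteHom {x x' : ℤ} {a : QuasiLocal d} (ha : a ∈ imageLoc α x)
    (M : Matrix (Finset.Ioc x x' → Fin d) (Finset.Ioc x x' → Fin d) ℂ) :
    Commute (α (siteHom d (Finset.Ioc x x') M)) a := by
  obtain ⟨b, hb, rfl⟩ := ha
  exact (commute_leftLoc hb (siteHom_mem _ M)).symm.map α

-- Raising `x` adds the tensor factor `α(A_{(x,x']})`, which commutes with `imageLoc α x` and hence
-- with `leftLoc d y`. So taking coefficients at its matrix units preserves the commutation with
-- `leftLoc d y`.
omit [NeZero d] in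
theorem relComm_eq_sup_right {x x' y : ℤ}
    (hle : leftLoc d y ≤ imageLoc α x) (hx : x ≤ x') :
    relComm α x' y =
      relComm α x y ⊔ (α.toStarAlgHom.comp (siteHom d (Finset.Ioc x x'))).range := by
  have hcomm : ∀ s ∈ relComm α x y, ∀ M,
      Commute (α.toStarAlgHom.comp (siteHom d (Finset.Ioc x x')) M) s := fun s hs M =>
    commute_image_siteHom (mem_relComm.1 hs).1 M
  apply le_antisymm
  · intro a ha
    rw [mem_sup_range_iff _ hcomm]
    intro u v
    obtain ⟨⟨b, hb, rfl⟩, hc⟩ := mem_relComm.1 ha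
    have hb' : b ∈ leftLoc d x' := hb
    rw [leftLoc_eq_sup hx, siteAlg, mem_sup_range_iff _ fun s hs M =>
      (commute_leftLoc hs (siteHom_mem _ M)).symm] at hb'
    have e : unitCoeff (α.toStarAlgHom.comp (siteHom d (Finset.Ioc x x'))) u v (α b) =
        α (unitCoeff (siteHom d (Finset.Ioc x x')) u v b) := by
      rw [unitCoeff_apply, unitCoeff_apply, map_sum]
      refine Finset.sum_congr rfl fun k _ => ?_
      rw [map_mul α, map_mul α]
      rfl
    refine mem_relComm.2 ⟨⟨_, hb' u v, e.symm⟩, fun c hc' => ?_⟩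
    exact Commute.sum_right _ _ _ fun k _ =>
      (((commute_image_siteHom (hle hc') _).symm.mul_right (hc c hc')).mul_right
        (commute_image_siteHom (hle hc') _).symm)
  · refine sup_le (relComm_mono hx le_rfl) ?_
    rintro _ ⟨M, rfl⟩
    exact mem_relComm.2 ⟨⟨_, siteAlg_le_leftLoc _ _ (siteHom_mem _ M), rfl⟩, fun b hb =>
      (commute_image_siteHom (hle hb) M).symm⟩

omit [NeZero d] in
theorem finrank_relComm_right {x x' y : ℤ}
    (hle : leftLoc d y ≤ imageLoc α x) (hx : x ≤ x') :
    Module.finrank ℂ (relComm α x' y) =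
      d ^ (2 * (x' - x).toNat) * Module.finrank ℂ (relComm α x y) := by
  rw [relComm_eq_sup_right hle hx, finrank_sup_range, card_config_Ioc, ← pow_mul, mul_comm 2]
  exact fun s hs M => commute_image_siteHom (mem_relComm.1 hs).1 M

/-- The square of the index, computed at `x` and `y`. -/
def indexRatio (α : QuasiLocal d ≃⋆ₐ[ℂ] QuasiLocal d) (x y : ℤ) : ℝ :=
  (Module.finrank ℂ (relComm α x y) : ℝ) / d ^ (2 * (x - y).toNat)

theorem indexRatio_eq_of_le (hα : (quditChain d).HasSpreadLE α l) {x y x' y' : ℤ} (hyx : y ≤ x)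
    (hle : leftLoc d y ≤ imageLoc α x) (hx : x ≤ x') (hy : y' ≤ y) :
    indexRatio α x' y' = indexRatio α x y := by
  have hd : (d : ℝ) ≠ 0 := Nat.cast_ne_zero.2 (NeZero.ne d)
  have e : (x' - y').toNat = (x' - x).toNat + (x - y).toNat + (y - y').toNat := by omega
  rw [indexRatio, indexRatio, finrank_relComm_left hα (hyx.trans hx)
    (hle.trans (imageLoc_mono hx)) hy, finrank_relComm_right hle hx, e, mul_add, mul_add, pow_add,
    pow_add]
  push_cast
  field_simp

/-- Both pairs are compared with the common pair `(max x x', min y y')`. -/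
theorem indexRatio_eq (hα : (quditChain d).HasSpreadLE α l) {x y x' y' : ℤ} (hyx : y ≤ x)
    (hle : leftLoc d y ≤ imageLoc α x) (hyx' : y' ≤ x') (hle' : leftLoc d y' ≤ imageLoc α x') :
    indexRatio α x y = indexRatio α x' y' :=
  (indexRatio_eq_of_le hα hyx hle (le_max_left x x') (min_le_left y y')).symm.trans
    (indexRatio_eq_of_le hα hyx' hle' (le_max_right x x') (min_le_right y y'))

theorem indexRatio_pos (hα : (quditChain d).HasSpreadLE α l) {x y : ℤ} (hyx : y ≤ x) :
    0 < indexRatio α x y := by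
  have hd : 0 < (d : ℝ) := Nat.cast_pos.2 (NeZero.pos d)
  have := finite_relComm hα (x := x) (y := y) (by omega)
  have hn : Nontrivial (QuasiLocal d) := by
    refine ⟨⟨0, 1, fun h => ?_⟩⟩
    have := congrArg (quditTrace d) h
    rw [map_zero, isTracialState_quditTrace.map_one] at this
    exact zero_ne_one this
  have : Nontrivial (relComm α x y) := ⟨⟨0, 1, fun h => zero_ne_one (congrArg Subtype.val h)⟩⟩
  have : 0 < Module.finrank ℂ (relComm α x y) := Module.finrank_pos
  exact div_pos (Nat.cast_pos.2 this) (by positivity)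

/-- The support algebra in the definition of the GNVW index is a relative commutant. -/
theorem supportAlgebra_eq_relComm {m : ℕ} (hα : (quditChain d).HasSpreadLE α m) (c : ℤ) :
    supportAlgebra ((siteAlg d (Finset.Ioc (c - 2 * m) c)).map α.toStarAlgHom)
      (siteAlg d (Finset.Ioc (c - m) (c + m))) (siteAlg d (Finset.Ioc (c - 3 * m) (c - m))) =
      relComm α c (c - m) := by
  have hle := leftLoc_le_imageLoc hα c
  apply le_antisymm
  -- The relative commutant is one of the competing algebras: `α` of the two cells lies in `imageLoc
  -- α c`, which splits over `c - m`.
  · refine sInf_le ⟨relComm_le hα (by omega), ?_⟩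
    rintro _ ⟨a, ha, rfl⟩
    refine mem_relComm_sup hle (z := c + m) (by omega) (by omega)
      ⟨a, siteAlg_le_leftLoc _ _ ha, rfl⟩ ?_
    have h2 := hα.map_mem ha
    rwa [show c - 2 * (m : ℤ) - m = c - 3 * m by ring] at h2
  -- Minimality: write `f = α b` and split the support of `b` at `c - 2m`. The left part is mapped
  -- to sites `≤ c - m` and the right part into `S ⊔ A_{(c-3m,c-m]}`. Since `f` commutes with
  -- everything left of `c - m`, it lies in `S`.
  · refine le_sInf fun S hS f hf => ?_
    obtain ⟨hS1, hS2⟩ := hS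
    obtain ⟨⟨b, ⟨w, hw⟩, hbf⟩, hc⟩ := mem_relComm.1 hf
    set v := min w (c - 2 * m) with hv
    have hw' := siteAlg_mono (Finset.Ioc_subset_Ioc_left (min_le_left w (c - 2 * m))) hw
    rw [← hv, ← Ioc_union (min_le_right w (c - 2 * m)) (by omega),
      siteAlg_union (disjoint_Ioc _ _ _)] at hw'
    have h1 : f ∈ S ⊔ siteAlg d (Finset.Ioc (v - m) (c - m)) := by
      have h2 : f ∈ (siteAlg d (Finset.Ioc (c - 2 * m) c) ⊔
          siteAlg d (Finset.Ioc v (c - 2 * m))).map α.toStarAlgHom := ⟨b, hw', hbf⟩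
      rw [StarSubalgebra.map_sup] at h2
      refine sup_le (hS2.trans (sup_le_sup_left (siteAlg_mono ?_) _)) ?_ h2
      · exact Finset.Ioc_subset_Ioc_left (by omega)
      · rintro _ ⟨a, ha, rfl⟩
        refine StarSubalgebra.mem_sup_right ?_
        have h3 := hα.map_mem ha
        rwa [show c - 2 * (m : ℤ) + m = c - m by ring] at h3
    exact mem_of_mem_sup_range (siteHom d (Finset.Ioc (v - m) (c - m)))
      (fun s hs M => commute_of_disjoint (disjoint_Ioc _ _ _) (siteHom_mem _ M) (hS1 hs)) h1
      fun M => hc _ (siteAlg_le_leftLoc _ _ (siteHom_mem _ M))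

theorem gnvwIndexAt_eq {m : ℕ} (hα : (quditChain d).HasSpreadLE α m) (c : ℤ) :
    (quditChain d).gnvwIndexAt α m c = √(indexRatio α c (c - m)) := by
  rw [AbstractSpinChain.gnvwIndexAt, quditChain_locIcc, quditChain_locIcc, quditChain_locIcc,
    quditChain_locIcc, supportAlgebra_eq_relComm hα, finrank_siteAlg, indexRatio]
  simp

/-! ## The subfactor index -/

variable {τ : QuasiLocal d →ₚ[ℂ] ℂ}

omit [NeZero d] in
theorem leftAlgebra_eq (x : ℤ) : (quditChain d).leftAlgebra τ x = gnsVN τ (leftLoc d x) := by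
  rw [gnsVN, coe_leftLoc]
  rfl

omit [NeZero d] in
theorem imageLeftAlgebra_eq (hτ : IsUniqueTracialState τ) (x : ℤ) :
    (quditChain d).imageLeftAlgebra hτ α x = gnsVN τ (imageLoc α x) := by
  rw [AbstractSpinChain.imageLeftAlgebra, leftAlgebra_eq, conj_gnsVN]
  rfl

/-- The relative commutant serves as the finite-dimensional factor. Its support in `(y, x + l]` is
disjoint from the sites `≤ y`, so the trace is multiplicative, and it is faithful there. -/
theorem IsTracialState.jonesIndex_imageLoc (hτ : IsTracialState τ)
    (hα : (quditChain d).HasSpreadLE α l) {x y : ℤ} (hyx : y ≤ x)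
    (hle : leftLoc d y ≤ imageLoc α x) :
    (gnsVN τ (imageLoc α x)).jonesIndex (gnsVN τ (leftLoc d y)) (gnsVector τ) =
      Module.finrank ℂ (relComm α x y) := by
  have hyl : y ≤ x + l := by omega
  have := finite_relComm hα hyl
  have hF := relComm_le hα hyl
  refine hτ.jonesIndex_gnsVN hle (fun a ha => (mem_relComm.1 ha).1)
    (fun a ha f hf => (mem_relComm.1 hf).2 a ha) ?_
    (fun f hf => hτ.eq_zero_of_map_star_mul_self (hF hf)) fun b hb => ?_
  · rintro a ⟨w, hw⟩ f hf
    exact hτ.map_mul_of_disjoint (disjoint_Ioc _ _ _) hw (hF hf)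
  · obtain ⟨w, hw⟩ := imageLoc_le hα x hb
    have hw' := siteAlg_mono (Finset.Ioc_subset_Ioc_left (min_le_left w y)) hw
    have hg := unitCoeff_mem_relComm hle (min_le_right w y) hyl hb hw'
    rw [← sum_single_mul_unitCoeff (siteHom d (Finset.Ioc (min w y) y)) b]
    refine sum_mem fun u _ => sum_mem fun v _ => Submodule.subset_span
      ⟨_, hg u v, _, siteAlg_le_leftLoc _ _ (siteHom_mem _ (single u v 1)),
        commute_unitCoeff _ _ _ _ _⟩

theorem IsTracialState.jonesIndex_leftLoc (hτ : IsTracialState τ) {x y : ℤ} (hyx : y ≤ x) :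
    (gnsVN τ (leftLoc d x)).jonesIndex (gnsVN τ (leftLoc d y)) (gnsVector τ) =
      (d ^ (2 * (x - y).toNat) : ℕ) := by
  have h := hτ.jonesIndex_imageLoc (hasSpreadLE_refl (d := d)) hyx
    ((leftLoc_mono hyx).trans (imageLoc_refl x).ge)
  rw [imageLoc_refl, relComm_refl hyx, finrank_siteAlg] at h
  simpa using h

theorem IsTracialState.gnsStarAlgHom_injOn (hτ : IsTracialState τ) {Λ : Finset ℤ}
    {a : QuasiLocal d} (ha : a ∈ siteAlg d Λ) (h : τ.gnsStarAlgHom a = 0) : a = 0 := by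
  refine hτ.eq_zero_of_map_star_mul_self ha ?_
  rw [← inner_gnsVector, h]
  simp

/-- The operator `a = α⁻¹ b` is local and its GNS image lies in the von Neumann algebra of the sites
`≤ x`. It therefore commutes with the sites in `(x, z]`; as the GNS representation is faithful on
local operators, `a` is supported on sites `≤ x`. -/
theorem leftLoc_le_imageLoc_of_gnsVN_le (hτ : IsUniqueTracialState τ)
    (hα : (quditChain d).HasSpreadLE α l) {x y : ℤ}
    (h : gnsVN τ (leftLoc d y) ≤ gnsVN τ (imageLoc α x)) : leftLoc d y ≤ imageLoc α x := by
  intro b hb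
  rw [mem_imageLoc]
  set a := α.symm b with ha
  have hab : α a = b := StarAlgEquiv.apply_symm_apply α b
  have h1 : τ.gnsStarAlgHom a ∈ gnsVN τ (leftLoc d x) := by
    have h2 := h (gnsStarAlgHom_mem_gnsVN hb)
    rw [imageLoc, ← conj_gnsVN hτ, mem_conj_iff, ← hab, ← gnsUnitary_conj hτ] at h2
    rwa [StarAlgEquiv.symm_apply_apply] at h2
  obtain ⟨w, hw⟩ := hα.symm.map_mem_leftLoc hb
  rw [← ha] at hw
  set v := min w x with hv
  set z := max (y + l) x with hz
  have hw' : a ∈ siteAlg d (Finset.Ioc v z) :=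
    siteAlg_mono (Finset.Ioc_subset_Ioc (min_le_left _ _) (le_max_left _ _)) hw
  have hvx : v ≤ x := min_le_right _ _
  have hxz : x ≤ z := le_max_right _ _
  have hc : ∀ c ∈ siteAlg d (Finset.Ioc x z), Commute c a := by
    intro c hc
    have h3 := mem_gnsVN_iff.1 h1 (τ.gnsStarAlgHom c) fun e he => by
      rw [← map_mul τ.gnsStarAlgHom, (commute_leftLoc he hc).eq, map_mul τ.gnsStarAlgHom]
    rw [← map_mul τ.gnsStarAlgHom, ← map_mul τ.gnsStarAlgHom] at h3
    have hc' := siteAlg_mono (Finset.Ioc_subset_Ioc_left hvx) hc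
    refine sub_eq_zero.1 (hτ.toIsTracialState.gnsStarAlgHom_injOn
      (sub_mem (mul_mem hc' hw') (mul_mem hw' hc')) ?_)
    rw [map_sub τ.gnsStarAlgHom, h3, sub_self]
  rw [← Ioc_union hvx hxz, Finset.union_comm] at hw'
  exact siteAlg_le_leftLoc _ _ (mem_siteAlg_of_commute (disjoint_Ioc _ _ _).symm hw' hc)

omit [NeZero d] in
theorem gnsVN_mono {B B' : StarSubalgebra ℂ (QuasiLocal d)} (h : B ≤ B') :
    gnsVN τ B ≤ gnsVN τ B' := fun _ hT =>
  mem_gnsVN_iff.2 fun X hX => mem_gnsVN_iff.1 hT X fun b hb => hX b (h hb)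

theorem hasIndex (hτ : IsUniqueTracialState τ) (hα : (quditChain d).HasSpreadLE α l) :
    (quditChain d).HasIndex hτ α √(indexRatio α 0 (0 - l)) := by
  constructor
  · refine ⟨0, 0 - l, by omega, ?_⟩
    rw [leftAlgebra_eq, imageLeftAlgebra_eq]
    exact gnsVN_mono (leftLoc_le_imageLoc hα 0)
  · intro x y hyx h
    rw [leftAlgebra_eq, imageLeftAlgebra_eq] at h
    have hle := leftLoc_le_imageLoc_of_gnsVN_le hτ hα h
    rw [leftAlgebra_eq, leftAlgebra_eq, imageLeftAlgebra_eq,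
      hτ.toIsTracialState.jonesIndex_imageLoc hα hyx hle,
      hτ.toIsTracialState.jonesIndex_leftLoc hyx]
    refine ⟨ENNReal.natCast_lt_top _, ENNReal.natCast_lt_top _, ?_⟩
    rw [indexRatio_eq hα (by omega) (leftLoc_le_imageLoc hα 0) hyx hle, indexRatio]
    simp

theorem hasGNVWIndex (hα : (quditChain d).HasSpreadLE α l) :
    (quditChain d).HasGNVWIndex α √(indexRatio α 0 (0 - l)) := by
  constructor
  -- The cell size must be at least `1`, while `l` may be `0`.
  · refine ⟨l + 1, by omega, fun I a ha => ?_⟩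
    have hmono : I.enlarge l ≤ I.enlarge (l + 1) :=
      ⟨show I.fst - ((l + 1 : ℕ) : ℤ) ≤ I.fst - l by omega,
        show I.snd + (l : ℤ) ≤ I.snd + ((l + 1 : ℕ) : ℤ) by omega⟩
    exact ⟨(quditChain d).mono hmono (hα I a ha).1, (quditChain d).mono hmono (hα I a ha).2⟩
  · intro m _ hm c
    -- The pair `(c, c - m)` satisfies the inclusion for every admissible `m`, so it has the same
    -- ratio as `(0, -l)`.
    rw [gnvwIndexAt_eq hm, indexRatio_eq hα (by omega) (leftLoc_le_imageLoc hα 0) (by omega)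
      (leftLoc_le_imageLoc hm c)]

/-! ### The finite index property of the qudit chain. -/

theorem isFactor_leftLoc (hτ : IsTracialState τ) (x : ℤ) : (gnsVN τ (leftLoc d x)).IsFactor := by
  refine hτ.isFactor_gnsVN fun φ hφ a ha => ?_
  obtain ⟨w, hw⟩ := ha
  refine eqOn_siteAlg (φ := φ) (ψ := φ 1 • τ.toLinearMap) (Finset.Ioc w x)
    (fun a ha b hb => hφ a ⟨w, ha⟩ b ⟨w, hb⟩) (fun a _ b _ => ?_) ?_ hw
  · exact congrArg (φ 1 * ·) (hτ.map_mul_comm a b)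
  · exact ((congrArg (φ 1 * ·) hτ.map_one).trans (mul_one _)).symm

/-- If the dimension were `D`, the faithfully represented algebra of the last `D` sites, of
dimension `d^(2D) > D`, would not fit. -/
theorem not_finiteDimensional_leftLoc (hd : 2 ≤ d) (hτ : IsTracialState τ) (x : ℤ) :
    ¬ FiniteDimensional ℂ (gnsVN τ (leftLoc d x)).toStarSubalgebra := by
  intro hfin
  set D := Module.finrank ℂ (gnsVN τ (leftLoc d x)).toStarSubalgebra
  let L : siteAlg d (Finset.Ioc (x - D) x) →ₗ[ℂ] (gnsVN τ (leftLoc d x)).toStarSubalgebra :=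
    { toFun := fun a => ⟨τ.gnsStarAlgHom a, gnsStarAlgHom_mem_gnsVN (siteAlg_le_leftLoc _ _ a.2)⟩
      map_add' := fun a b => Subtype.ext (map_add τ.gnsStarAlgHom a.1 b.1)
      map_smul' := fun c a => Subtype.ext (map_smul τ.gnsStarAlgHom c a.1) }
  have hL : Function.Injective L := by
    intro a b hab
    have h1 : τ.gnsStarAlgHom a.1 = τ.gnsStarAlgHom b.1 := congrArg Subtype.val hab
    refine Subtype.ext (sub_eq_zero.1 (hτ.gnsStarAlgHom_injOn (sub_mem a.2 b.2) ?_))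
    rw [map_sub τ.gnsStarAlgHom, h1, sub_self]
  have h1 := LinearMap.finrank_le_finrank_of_injective hL
  rw [finrank_siteAlg] at h1
  have h2 : (Finset.Ioc (x - D) x).card = D := by simp
  rw [h2] at h1
  have h3 : D < d ^ D := Nat.lt_pow_self hd
  have h4 : d ^ D ≤ d ^ (2 * D) := Nat.pow_le_pow_right (by omega) (by omega)
  omega

theorem finiteIndexProperty (hd : 2 ≤ d) (hτ : IsUniqueTracialState τ) :
    (quditChain d).FiniteIndexProperty hτ where
  isFactor x := leftAlgebra_eq (τ := τ) x ▸ isFactor_leftLoc hτ.toIsTracialState x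
  infiniteDimensional x :=
    leftAlgebra_eq (τ := τ) x ▸ not_finiteDimensional_leftLoc hd hτ.toIsTracialState x
  finite_index x z hxz := by
    rw [leftAlgebra_eq, leftAlgebra_eq, hτ.toIsTracialState.jonesIndex_leftLoc hxz.le]
    exact ENNReal.natCast_lt_top _

end QCAIndex

end
/-- For `d ≥ 2` the qudit chain has a unique tracial state and the finite index property, and for
every quantum cellular automaton of it the subfactor index equals the GNVW index. -/
theorem mainTheorem5 (d : ℕ) (hd : 2 ≤ d) :
    ∃ (τ : QuasiLocal d →ₚ[ℂ] ℂ) (hτ : IsUniqueTracialState τ),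
      (quditChain d).FiniteIndexProperty hτ ∧
      ∀ α : QuasiLocal d ≃⋆ₐ[ℂ] QuasiLocal d, (quditChain d).IsQCA α →
        ∃ r : ℝ, 0 < r ∧ (quditChain d).HasIndex hτ α r ∧ (quditChain d).HasGNVWIndex α r := by
  have : NeZero d := ⟨by omega⟩
  refine ⟨quditTrace d, isTracialState_quditTrace.isUnique, finiteIndexProperty hd _, ?_⟩
  rintro α ⟨l, hα⟩
  exact ⟨_, Real.sqrt_pos.2 (indexRatio_pos hα (by omega)), hasIndex _ hα, hasGNVWIndex hα⟩
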